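/- **Definitions.** A *ribbon graph* $\mathbb G=(V,E)$ is an orientable surface with boundary that is the union of finitely many vertex discs $V$ and edge discs $E$, where vertices and edges meet in disjoint arcs, each arc lies on exactly one vertex and one edge, and each edge contains exactly two arcs. A *packaged ribbon graph* $\underline{\mathbb G}=(\mathbb G,\mathcal V,\omega_{\mathcal V},\mathcal F,\omega_{\mathcal F})$ is a ribbon graph $\mathbb G$ with a partition $\mathcal V$ of its vertex set, a partition $\mathcal F$ of its set of boundary components, and weightings $\omega_{\mathcal V}:\mathcal V\to\mathbb N_0$, $\omega_{\mathcal F}:\mathcal F\to\mathbb N_0$. For an edge $e$, $\eta(e)$ is the number of blocks of $\mathcal F$ containing a boundary component that meets $e$, and $\mu(e)$ is the number of blocks of $\mathcal V$ containing a vertex incident to $e$. *Deletion* $\underline{\mathbb G}\backslash e$: remove the edge disc $e$; keep $\mathcal V$ and $\omega_{\mathcal V}$. The one or two boundary components $f,g$ that meet $e$ are replaced by the one or two boundary components formed by the deletion. If $[f]=[g]$ (in particular if $f=g$), the new components replace $f,g$ in this block and its weight grows by $1$; if $[f]\ne[g]$, the two blocks are united, the new component replaces $f,g$, and the weights are added.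 Other blocks and weights are unchanged. *Contraction* $\underline{\mathbb G}/e$: let $u,v$ be the (possibly equal) vertices incident to $e$. Attach a disc, a new vertex, along each boundary curve of $e\cup u\cup v$, and delete $e,u,v$. The boundary components correspond naturally to those of $\mathbb G$, which carries over $\mathcal F,\omega_{\mathcal F}$. If $[u]=[v]$ (in particular if $u=v$), the new vertices replace $u,v$ in this block and its weight grows by $1$; if $[u]\neq[v]$, the two blocks are united, the new vertex replaces $u,v$, and the weights are added. Other blocks and weights are unchanged. For $A\subseteq E$ let $\mathbb G|A=(V,A)$. The *packaging* $G(\mathbb G|A;\mathcal V)$ is the multigraph with vertex set $\mathcal V$ in which every edge of $A$ joins the blocks of its incident vertices. For a subgraph $K$ of it, $\mathbb G[K]$ is the ribbon subgraph formed by the vertices in the blocks of $K$ and the edges of $K$. Write $v,e,k$ for the numbers of vertices, edges and connected components of a graph, $n=e-v+k$, $f$ for the number of boundary components, $\omega_{\mathcal V}(K)=\sum_{B\in V(K)}\omega_{\mathcal V}(B)$, and $$g(\mathbb G,K)=\tfrac12\bigl(2k(K)+e(K)-v(K)+\omega_{\mathcal V}(K)-f(\mathbb G[K])\bigr)\in\tfrac12\mathbb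 Z .$$ Let $\mathbb G^*$ be the geometric dual, whose edges are those of $\mathbb G$ and whose vertices are the boundary components of $\mathbb G$ (so $\mathcal F$ is a partition of its vertices, and $G(\mathbb G^*|A^c;\mathcal F)$ and $g(\mathbb G^*,H)$ are defined in the same way from $\mathcal F,\omega_{\mathcal F}$). With variables $x,y$ and $x_g,y_g$ for $g\in\frac12\mathbb Z$, the *packaged surface Tutte polynomial* is $$\boldsymbol T(\underline{\mathbb G};\boldsymbol x,\boldsymbol y)=\sum_{A\subseteq E}x^{n(G(\mathbb G^*|A^c;\mathcal F))}\,y^{n(G(\mathbb G|A;\mathcal V))}\prod_{H}x_{g(\mathbb G^*,H)}\prod_{K}y_{g(\mathbb G,K)},$$ where $A^c=E\setminus A$ and $H$, $K$ run over the connected components of $G(\mathbb G^*|A^c;\mathcal F)$ and $G(\mathbb G|A;\mathcal V)$ respectively. **Theorem 3.4 (Universality).** There is a unique map $U$ from packaged ribbon graphs to $\mathbb Z[\alpha,\beta,\kappa,\tau,\boldsymbol a,\boldsymbol b]$, where $\boldsymbol a=(a_i)_{i\in\mathbb Z}$ and $\boldsymbol b=(b_i)_{i\in\mathbb Z}$,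 such that $$U(\underline{\mathbb G})=\begin{cases}\alpha U(\underline{\mathbb G}\backslash e)+\beta U(\underline{\mathbb G}/e)&\text{if }\eta(e)=1,\ \mu(e)=1,\\ \alpha U(\underline{\mathbb G}\backslash e)+\kappa U(\underline{\mathbb G}/e)&\text{if }\eta(e)=1,\ \mu(e)=2,\\ \tau U(\underline{\mathbb G}\backslash e)+\beta U(\underline{\mathbb G}/e)&\text{if }\eta(e)=2,\ \mu(e)=1,\\ \tau U(\underline{\mathbb G}\backslash e)+\kappa U(\underline{\mathbb G}/e)&\text{if }\eta(e)=2,\ \mu(e)=2\end{cases}$$ for every packaged ribbon graph $\underline{\mathbb G}$ and every edge $e$ of it, and $$U(\underline{\mathbb G})=\prod_{B\in\mathcal F}\tau\, a_{\omega_{\mathcal F}(B)-|B|}\ \prod_{B\in\mathcal V}\kappa\, b_{\omega_{\mathcal V}(B)-|B|}$$ if $\mathbb G$ has no edges. This $U$ is an isomorphism invariant of packaged ribbon graphs. Furthermore, $$U(\underline{\mathbb G})=\tau^{|\mathcal F|}\kappa^{|\mathcal V|}\,\boldsymbol T(\underline{\mathbb G};\boldsymbol x,\boldsymbol y)\quad\text{with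 } x=\alpha,\ y=\beta,\ x_g=a_{2g-1},\ y_g=b_{2g-1}\ \text{ for all } g\in\tfrac12\mathbb Z .$$ -/

import Mathlib

open Equiv

namespace PackagedRibbon

/-! ### Cycles of a permutation -/

/-- The set of cycles (orbits, fixed points included) of a permutation. -/
def Cycles {X : Type} (p : Perm X) : Type := Quotient (Perm.SameCycle.setoid p)

/-- The cycle through a point. -/
def cyc {X : Type} (p : Perm X) (x : X) : Cycles p := Quotient.mk (Perm.SameCycle.setoid p) x

instance {X : Type} [Finite X] (p : Perm X) : Finite (Cycles p) :=
  inferInstanceAs (Finite (Quotient (Perm.SameCycle.setoid p)))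

theorem sameCycle_invariant {X B : Type} {p : Perm X} {f : X → B} (hf : ∀ x, f (p x) = f x)
    {x y : X} (h : p.SameCycle x y) : f x = f y := by
  obtain ⟨i, rfl⟩ := h
  induction i with
  | zero => simp
  | succ n ih => rw [ih, add_comm, zpow_add, Perm.mul_apply, zpow_one, hf]
  | pred n ih =>
    rw [ih]
    have h1 : p ((p ^ (-(n : ℤ) - 1)) x) = (p ^ (-(n : ℤ))) x := by
      rw [← Perm.mul_apply, ← zpow_one_add]
      congr 2
      ring
    rw [← h1, hf]

/-- A function that is constant along `p` descends to the cycles of `p`. -/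
def Cycles.lift {X B : Type} {p : Perm X} (f : X → B) (hf : ∀ x, f (p x) = f x) : Cycles p → B :=
  Quotient.lift f fun _ _ h => sameCycle_invariant hf h

open Classical in
/-- Remove `a` from its cycle: `a` becomes a fixed point, the predecessor of `a` is sent to the
successor of `a`, and nothing else changes. -/
noncomputable def skip {X : Type} (p : Perm X) (a : X) : Perm X := swap a (p a) * p

theorem skip_apply_self {X : Type} (p : Perm X) (a : X) : skip p a a = a := by
  simp [skip]

theorem skip_apply_of_fixed {X : Type} (p : Perm X) (a : X) {b : X} (hb : p b = b) :
    skip p a b = b := by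
  classical
  by_cases hab : b = a
  · subst hab; exact skip_apply_self p b
  · have h2 : b ≠ p a := fun h => hab (p.injective (hb.trans h))
    simp [skip, hb, swap_apply_of_ne_of_ne hab h2]

theorem skip_invariant {X B : Type} (p : Perm X) (a : X) (f : X → B) (ha : f (p a) = f a) (x : X) :
    f (skip p a x) = f (p x) := by
  classical
  simp only [skip, Perm.mul_apply, swap_apply_def]
  split_ifs with h1 h2
  · rw [h1, ha]
  · rw [h2, ha]
  · rfl

/-- Remove `a` and `b` from the cycles of `p`, and keep the cyclic orders of the other points. -/
noncomputable def skipTwo {X : Type} (p : Perm X) (a b : X) : Perm {x : X // x ≠ a ∧ x ≠ b} :=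
  (skip (skip p a) b).subtypePerm fun x => by
    have ha : skip (skip p a) b a = a := skip_apply_of_fixed _ _ (skip_apply_self p a)
    have hb : skip (skip p a) b b = b := skip_apply_self _ b
    have ia : skip (skip p a) b x = a ↔ x = a :=
      ⟨fun h => (skip (skip p a) b).injective (h.trans ha.symm), fun h => by rw [h, ha]⟩
    have ib : skip (skip p a) b x = b ↔ x = b :=
      ⟨fun h => (skip (skip p a) b).injective (h.trans hb.symm), fun h => by rw [h, hb]⟩
    rw [ne_eq, ne_eq, ia, ib]

theorem skipTwo_invariant {X B : Type} (p : Perm X) (a b : X) (f : X → B)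
    (ha : f (p a) = f a) (hb : f (p b) = f b) (x : {x : X // x ≠ a ∧ x ≠ b}) :
    f (skipTwo p a b x).1 = f (p x.1) := by
  have h1 : (skipTwo p a b x).1 = skip (skip p a) b x.1 := rfl
  rw [h1, skip_invariant _ b f (by rw [skip_invariant p a f ha, hb]), skip_invariant p a f ha]

/-! ### Ribbon graphs -/

/-- An orientable ribbon graph, as a rotation system. Every edge disc has two ends, the darts
(half-edges). Choose an orientation of the surface: `rot` sends a dart to the next one around its
vertex disc and `inv` sends a dart to the other end of the same edge. The vertex discs that meet
an edge are the cycles of `rot`; those that meet no edge are listed by `Isolated`. The choice of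
the orientation is forgotten in `PackagedRibbonGraph.Isomorphism`. -/
structure RibbonGraph where
  /-- the ends of edges -/
  Dart : Type
  /-- the vertices that meet no edge -/
  Isolated : Type
  [finite_dart : Finite Dart]
  [finite_isolated : Finite Isolated]
  /-- the next dart around the vertex -/
  rot : Perm Dart
  /-- the other end of the edge -/
  inv : Perm Dart
  inv_inv : ∀ h, inv (inv h) = h
  inv_ne : ∀ h, inv h ≠ h

attribute [instance] RibbonGraph.finite_dart RibbonGraph.finite_isolated

namespace RibbonGraph

variable (G : RibbonGraph)

/-- The vertices. -/
def Vertex : Type := Cycles G.rot ⊕ G.Isolated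

/-- The edges. -/
def Edge : Type := Cycles G.inv

/-- The boundary components. One follows the boundary of the surface from the side of an edge at
the dart `h` along the edge to its other end `inv h`, and then along the boundary of the vertex
to the next dart `rot (inv h)`; the boundary of an isolated vertex is one more component. So the
edge of `h` has two sides, which lie on the components of `h` and of `inv h`. -/
def Face : Type := Cycles (G.rot * G.inv) ⊕ G.Isolated

instance : Finite G.Vertex := inferInstanceAs (Finite (Cycles G.rot ⊕ G.Isolated))
instance : Finite G.Edge := inferInstanceAs (Finite (Cycles G.inv))
instance : Finite G.Face := inferInstanceAs (Finite (Cycles (G.rot * G.inv) ⊕ G.Isolated))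

/-- The vertex that is incident to a dart. -/
def vertexOf (h : G.Dart) : G.Vertex := Sum.inl (cyc G.rot h)

/-- The edge of a dart. -/
def edgeOf (h : G.Dart) : G.Edge := cyc G.inv h

/-- The boundary component at a dart. -/
def faceOf (h : G.Dart) : G.Face := Sum.inl (cyc (G.rot * G.inv) h)

/-- The geometric dual: its vertices are the boundary components, and the edges around a dual
vertex are met in the order in which one follows the boundary component. -/
def dual : RibbonGraph where
  Dart := G.Dart
  Isolated := G.Isolated
  rot := G.rot * G.inv
  inv := G.inv
  inv_inv := G.inv_inv
  inv_ne := G.inv_ne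

theorem rot_vertexOf (h : G.Dart) : G.vertexOf (G.rot h) = G.vertexOf h :=
  congrArg Sum.inl (Quotient.sound' (Perm.SameCycle.symm ⟨1, by simp⟩))

theorem rot_faceOf (h : G.Dart) : G.faceOf (G.rot h) = G.faceOf (G.inv h) := by
  refine congrArg Sum.inl (Quotient.sound' (Perm.SameCycle.symm ⟨1, ?_⟩))
  simp [G.inv_inv]

/-- The ribbon graph on the darts other than the two ends `d`, `inv d` of an edge, whose vertices
are bounded by the cycles of `ρ` (a permutation of all the darts) with the two ends taken out. A
cycle that consists of ends of the removed edge only leaves a vertex that meets no edge. -/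
noncomputable def removeEdge (d : G.Dart) (ρ : Perm G.Dart) : RibbonGraph where
  Dart := {h : G.Dart // h ≠ d ∧ h ≠ G.inv d}
  Isolated := G.Isolated ⊕ {c : Cycles ρ // ∀ h, cyc ρ h = c → h = d ∨ h = G.inv d}
  rot := skipTwo ρ d (G.inv d)
  inv := G.inv.subtypePerm fun x => by
    constructor
    · rintro ⟨h1, h2⟩
      exact ⟨fun h => h2 (by rw [h]), fun h => h1 (by rw [h, G.inv_inv])⟩
    · rintro ⟨h1, h2⟩
      exact ⟨fun h => h2 (by rw [← h, G.inv_inv]), fun h => h1 (G.inv.injective h)⟩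
  inv_inv h := Subtype.ext (G.inv_inv h.1)
  inv_ne h := fun h' => G.inv_ne h.1 (congrArg Subtype.val h')

/-- Deletion of the edge with the end `d`: the vertices stay, the edge goes. -/
noncomputable def delete (d : G.Dart) : RibbonGraph := G.removeEdge d G.rot

open Classical in
/-- The boundary curves of the union of the edge with the end `d` and its incident vertices, as
cycles of darts (the other vertices are kept): a curve that arrives at one end of the edge follows
the side of the edge and goes on around the vertex from the other end. -/
noncomputable def curves (d : G.Dart) : Perm G.Dart := G.rot * swap d (G.inv d)

/-- Contraction of the edge with the end `d`: the boundary curves of the union of the edge and its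
incident vertices become the boundaries of new vertices. -/
noncomputable def contract (d : G.Dart) : RibbonGraph := G.removeEdge d (G.curves d)

theorem curves_left (d : G.Dart) : G.curves d d = G.rot (G.inv d) := by simp [curves]

theorem curves_right (d : G.Dart) : G.curves d (G.inv d) = G.rot d := by simp [curves]

theorem curves_of_ne (d : G.Dart) {h : G.Dart} (h1 : h ≠ d) (h2 : h ≠ G.inv d) :
    G.curves d h = G.rot h := by
  classical
  simp [curves, swap_apply_of_ne_of_ne h1 h2]

open Classical in
/-- The involution that exchanges the two ends of each edge of `A` and fixes all other darts. -/
noncomputable def flip (A : Set G.Edge) : Perm G.Dart :=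
  Function.Involutive.toPerm (fun h => if G.edgeOf h ∈ A then G.inv h else h) (by
    intro h
    have he : G.edgeOf (G.inv h) = G.edgeOf h :=
      Quotient.sound' (Perm.SameCycle.symm ⟨1, by simp⟩)
    by_cases hA : G.edgeOf h ∈ A
    · simp [hA, he, G.inv_inv]
    · simp [hA])

/-- The number of boundary components of the ribbon subgraph with vertex set `U` and edge set `A`
(edges whose incident vertices lie in `U`). Its boundary runs along the edges of `A` as in `Face`
and passes by the darts of all other edges. -/
noncomputable def numBoundary (U : Set G.Vertex) (A : Set G.Edge) : ℕ :=
  {c : Cycles (G.rot * G.flip A) | ∃ h, G.vertexOf h ∈ U ∧ cyc _ h = c}.ncard +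
    {i : G.Isolated | (Sum.inr i : G.Vertex) ∈ U}.ncard

end RibbonGraph

/-! ### Weighted partitions -/

/-- A partition of `X` (as an equivalence relation) with a weight on each of its blocks. -/
structure WeightedPartition (X : Type) where
  rel : Setoid X
  weight : Quotient rel → ℕ

namespace WeightedPartition

variable {X Y : Type} (P : WeightedPartition X)

/-- The blocks. -/
abbrev Blocks : Type := Quotient P.rel

/-- The block of an element. -/
def block (x : X) : P.Blocks := Quotient.mk P.rel x

/-- The number of elements of a block. -/
noncomputable def size (b : P.Blocks) : ℕ := {x : X | P.block x = b}.ncard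

/-- The partition of `Y` into the nonempty fibres of `f`, where the fibre of `b` has weight
`w b`. -/
def ofMap {B : Type} (f : Y → B) (w : B → ℕ) : WeightedPartition Y where
  rel := Setoid.ker f
  weight := fun c => w (Setoid.kerLift f c)

open Classical in
/-- Unite the blocks `b₁` and `b₂` (under the name `b₁`); nothing happens if they are equal. -/
noncomputable def merge (b₁ b₂ : P.Blocks) (b : P.Blocks) : P.Blocks := if b = b₂ then b₁ else b

open Classical in
/-- The weight after `b₁` and `b₂` have been united under the name `b₁`: the sum of the two weights
if they are different blocks, one more than the weight if they are equal. -/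
noncomputable def mergeWeight (b₁ b₂ : P.Blocks) (b : P.Blocks) : ℕ :=
  if b = b₁ then (if b₁ = b₂ then P.weight b₁ + 1 else P.weight b₁ + P.weight b₂) else P.weight b

theorem merge_left (b₁ b₂ : P.Blocks) : P.merge b₁ b₂ b₁ = b₁ := by
  simp [merge]

theorem merge_right (b₁ b₂ : P.Blocks) : P.merge b₁ b₂ b₂ = b₁ := by
  simp [merge]

end WeightedPartition

/-! ### Packaged ribbon graphs -/

/-- A packaged ribbon graph: a ribbon graph with a weighted partition of its vertices and a
weighted partition of its boundary components. -/
structure PackagedRibbonGraph where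
  graph : RibbonGraph
  vert : WeightedPartition graph.Vertex
  face : WeightedPartition graph.Face

namespace PackagedRibbonGraph

variable (G : PackagedRibbonGraph)

/-- The block of the vertex at a dart. -/
def vblock (h : G.graph.Dart) : G.vert.Blocks := G.vert.block (G.graph.vertexOf h)

/-- The block of the boundary component at a dart. -/
def fblock (h : G.graph.Dart) : G.face.Blocks := G.face.block (G.graph.faceOf h)

/-- The number of blocks that contain a boundary component that intersects the edge of `d`. -/
noncomputable def eta (d : G.graph.Dart) : ℕ :=
  ({G.fblock d, G.fblock (G.graph.inv d)} : Set G.face.Blocks).ncard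

/-- The number of blocks that contain a vertex that is incident to the edge of `d`. -/
noncomputable def mu (d : G.graph.Dart) : ℕ :=
  ({G.vblock d, G.vblock (G.graph.inv d)} : Set G.vert.Blocks).ncard

/-- The vertices of the ribbon graph with the edge of `d` deleted are those of the ribbon graph. -/
noncomputable def deleteVertexMap (d : G.graph.Dart) :
    (G.graph.delete d).Vertex → G.graph.Vertex
  | Sum.inl c => Cycles.lift (p := (G.graph.delete d).rot) (fun h => G.graph.vertexOf h.1)
      (fun h => by
        have := skipTwo_invariant G.graph.rot d (G.graph.inv d) G.graph.vertexOf
          (G.graph.rot_vertexOf _) (G.graph.rot_vertexOf _) h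
        exact this.trans (G.graph.rot_vertexOf _)) c
  | Sum.inr (Sum.inl i) => Sum.inr i
  | Sum.inr (Sum.inr c) => Sum.inl c.1

/-- The name of the block of a boundary component after the edge of `d` has been deleted: the
blocks of the boundary components on the two sides of the edge are united, and the boundary
components formed by the deletion lie in the united block. -/
noncomputable def deleteFaceBlock (d : G.graph.Dart) :
    (G.graph.delete d).Face → G.face.Blocks
  | Sum.inl c => Cycles.lift (p := (G.graph.delete d).rot * (G.graph.delete d).inv)
      (fun h => G.face.merge (G.fblock d) (G.fblock (G.graph.inv d)) (G.fblock h.1))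
      (fun h => by
        have hr : ∀ x, G.fblock (G.graph.rot x) = G.fblock (G.graph.inv x) := fun x =>
          congrArg G.face.block (G.graph.rot_faceOf x)
        have := skipTwo_invariant G.graph.rot d (G.graph.inv d)
          (fun x => G.face.merge (G.fblock d) (G.fblock (G.graph.inv d)) (G.fblock x))
          (by simp only [hr, WeightedPartition.merge_left, WeightedPartition.merge_right])
          (by simp only [hr, G.graph.inv_inv, WeightedPartition.merge_left,
            WeightedPartition.merge_right])
          ((G.graph.delete d).inv h)
        refine this.trans ?_
        have hi : ((G.graph.delete d).inv h).1 = G.graph.inv h.1 := rfl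
        simp only [hi, hr, G.graph.inv_inv]) c
  | Sum.inr (Sum.inl i) =>
      G.face.merge (G.fblock d) (G.fblock (G.graph.inv d)) (G.face.block (Sum.inr i))
  | Sum.inr (Sum.inr _) => G.fblock d

/-- Deletion of the edge with the end `d`. -/
noncomputable def delete (d : G.graph.Dart) : PackagedRibbonGraph where
  graph := G.graph.delete d
  vert := WeightedPartition.ofMap (fun v => G.vert.block (G.deleteVertexMap d v)) G.vert.weight
  face := WeightedPartition.ofMap (G.deleteFaceBlock d)
    (G.face.mergeWeight (G.fblock d) (G.fblock (G.graph.inv d)))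

/-- The natural correspondence from the boundary components of the ribbon graph with the edge of
`d` contracted to those of the ribbon graph. (A new vertex that meets no edge is bounded by a
curve along the contracted edge only, and this curve is the boundary component at any of its
darts.) -/
noncomputable def contractFaceMap (d : G.graph.Dart) :
    (G.graph.contract d).Face → G.graph.Face
  | Sum.inl c => Cycles.lift (p := (G.graph.contract d).rot * (G.graph.contract d).inv)
      (fun h => G.graph.faceOf h.1)
      (fun h => by
        have := skipTwo_invariant (G.graph.curves d) d (G.graph.inv d) G.graph.faceOf
          (by rw [G.graph.curves_left, G.graph.rot_faceOf, G.graph.inv_inv])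
          (by rw [G.graph.curves_right, G.graph.rot_faceOf])
          ((G.graph.contract d).inv h)
        refine this.trans ?_
        rw [G.graph.curves_of_ne d ((G.graph.contract d).inv h).2.1
          ((G.graph.contract d).inv h).2.2, G.graph.rot_faceOf]
        have hi : ((G.graph.contract d).inv h).1 = G.graph.inv h.1 := rfl
        rw [hi, G.graph.inv_inv]) c
  | Sum.inr (Sum.inl i) => Sum.inr i
  | Sum.inr (Sum.inr c) => G.graph.faceOf (Quotient.out c.1)

/-- The name of the block of a vertex after the edge of `d` has been contracted: the blocks of the
vertices at the two ends of the edge are united, and the vertices formed by the contraction lie in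
the united block. -/
noncomputable def contractVertexBlock (d : G.graph.Dart) :
    (G.graph.contract d).Vertex → G.vert.Blocks
  | Sum.inl c => Cycles.lift (p := (G.graph.contract d).rot)
      (fun h => G.vert.merge (G.vblock d) (G.vblock (G.graph.inv d)) (G.vblock h.1))
      (fun h => by
        have hr : ∀ x, G.vblock (G.graph.rot x) = G.vblock x := fun x =>
          congrArg G.vert.block (G.graph.rot_vertexOf x)
        have := skipTwo_invariant (G.graph.curves d) d (G.graph.inv d)
          (fun x => G.vert.merge (G.vblock d) (G.vblock (G.graph.inv d)) (G.vblock x))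
          (by simp only [G.graph.curves_left, hr, WeightedPartition.merge_left,
            WeightedPartition.merge_right])
          (by simp only [G.graph.curves_right, hr, WeightedPartition.merge_left,
            WeightedPartition.merge_right])
          h
        refine this.trans ?_
        rw [G.graph.curves_of_ne d h.2.1 h.2.2, hr]) c
  | Sum.inr (Sum.inl i) =>
      G.vert.merge (G.vblock d) (G.vblock (G.graph.inv d)) (G.vert.block (Sum.inr i))
  | Sum.inr (Sum.inr _) => G.vblock d

/-- Contraction of the edge with the end `d`. -/
noncomputable def contract (d : G.graph.Dart) : PackagedRibbonGraph where
  graph := G.graph.contract d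
  vert := WeightedPartition.ofMap (G.contractVertexBlock d)
    (G.vert.mergeWeight (G.vblock d) (G.vblock (G.graph.inv d)))
  face := WeightedPartition.ofMap (fun f => G.face.block (G.contractFaceMap d f)) G.face.weight

open Classical in
/-- An isomorphism (homeomorphism that respects vertices, edges, partitions and weights) of packaged
ribbon graphs. It may reverse the chosen orientation on some of the connected components, namely
at the darts where `rev` holds; there, the side of an edge that is labelled by the dart `h` becomes
the side that is labelled by the other end of the image of `h`. -/
structure Isomorphism (G G' : PackagedRibbonGraph) where
  dart : G.graph.Dart ≃ G'.graph.Dart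
  isolated : G.graph.Isolated ≃ G'.graph.Isolated
  rev : G.graph.Dart → Prop
  rev_rot : ∀ h, rev (G.graph.rot h) ↔ rev h
  rev_inv : ∀ h, rev (G.graph.inv h) ↔ rev h
  map_inv : ∀ h, dart (G.graph.inv h) = G'.graph.inv (dart h)
  map_rot : ∀ h, ¬ rev h → dart (G.graph.rot h) = G'.graph.rot (dart h)
  map_rot_rev : ∀ h, rev h → dart (G.graph.rot h) = G'.graph.rot.symm (dart h)
  /-- the bijection on the vertices -/
  vertex : G.graph.Vertex ≃ G'.graph.Vertex
  vertex_dart : ∀ h, vertex (G.graph.vertexOf h) = G'.graph.vertexOf (dart h)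
  vertex_isolated : ∀ i, vertex (Sum.inr i) = Sum.inr (isolated i)
  /-- the bijection on the boundary components -/
  face : G.graph.Face ≃ G'.graph.Face
  face_dart : ∀ h, face (G.graph.faceOf h) =
    G'.graph.faceOf (if rev h then G'.graph.inv (dart h) else dart h)
  face_isolated : ∀ i, face (Sum.inr i) = Sum.inr (isolated i)
  vert_rel : ∀ v w, G.vert.rel v w ↔ G'.vert.rel (vertex v) (vertex w)
  vert_weight : ∀ v, G'.vert.weight (G'.vert.block (vertex v)) = G.vert.weight (G.vert.block v)
  face_rel : ∀ f g, G.face.rel f g ↔ G'.face.rel (face f) (face g)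
  face_weight : ∀ f, G'.face.weight (G'.face.block (face f)) = G.face.weight (G.face.block f)

end PackagedRibbonGraph

/-! ### Graphs -/

section Multigraph

variable {W D : Type} (K : Graph W D)

/-- The connected components of a graph. -/
def Components : Type := Quot fun x y : K.vertexSet => K.Adj x y

/-- A connected component, as a graph. -/
def component (c : Components K) : Graph W D :=
  K.induce {x : W | ∃ hx : x ∈ K.vertexSet, Quot.mk _ (⟨x, hx⟩ : K.vertexSet) = c}

/-- The number `k(K)` of connected components. -/
noncomputable def numComponents : ℕ := Nat.card (Components K)

/-- The nullity `e(K) - v(K) + k(K)`, which is never negative for a finite graph. -/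
noncomputable def nullity : ℕ := K.edgeSet.ncard + numComponents K - K.vertexSet.ncard

end Multigraph

/-! ### The packaged surface Tutte polynomial -/

section Tutte

variable (G : RibbonGraph) (P : WeightedPartition G.Vertex)

/-- The packaging of the spanning ribbon subgraph with edge set `A`: its vertices are the blocks of
the partition, and each edge of `A` joins the blocks of its incident vertices. -/
def packaging (A : Set G.Edge) : Graph P.Blocks G.Edge where
  vertexSet := Set.univ
  edgeSet := A
  IsLink e b c := e ∈ A ∧ ∃ h, G.edgeOf h = e ∧ b = P.block (G.vertexOf h) ∧
    c = P.block (G.vertexOf (G.inv h))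
  isLink_symm e _ := ⟨fun b c ⟨hA, h, he, hb, hc⟩ => ⟨hA, G.inv h,
    (Quotient.sound' (Perm.SameCycle.symm ⟨1, by simp⟩) : G.edgeOf (G.inv h) = G.edgeOf h).trans he,
    hc, by rw [G.inv_inv, hb]⟩⟩
  eq_or_eq_of_isLink_of_isLink := by
    rintro e x y v w ⟨-, h, he, hx, hy⟩ ⟨-, k, hk, hv, hw⟩
    have h1 : G.inv.SameCycle h k := Quotient.exact (he.trans hk.symm)
    have h2 : k = h ∨ k = G.inv h := by
      have hf : ∀ x, (fun x => x = h ∨ x = G.inv h) (G.inv x) =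
          (fun x => x = h ∨ x = G.inv h) x := by
        intro x
        have e1 : G.inv x = h ↔ x = G.inv h :=
          ⟨fun t => by rw [← t, G.inv_inv], fun t => by rw [t, G.inv_inv]⟩
        have e2 : G.inv x = G.inv h ↔ x = h := G.inv.injective.eq_iff
        simp only [e1, e2, or_comm]
      have := sameCycle_invariant (f := fun x => x = h ∨ x = G.inv h) hf h1
      exact this.mp (Or.inl rfl)
    rcases h2 with rfl | rfl
    · exact Or.inl (hx.trans hv.symm)
    · exact Or.inr (by rw [hx, hw, G.inv_inv])
  edge_mem_iff_exists_isLink e := by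
    constructor
    · intro hA
      obtain ⟨h, rfl⟩ := Quotient.exists_rep e
      exact ⟨_, _, hA, h, rfl, rfl, rfl⟩
    · rintro ⟨_, _, hA, _⟩
      exact hA
  left_mem_of_isLink _ _ _ _ := Set.mem_univ _

/-- The number of boundary components of the ribbon subgraph that corresponds to a subgraph `K` of
the packaging: all vertices in the blocks of `K`, and the edges of `K`. -/
noncomputable def numBoundaryOf (K : Graph P.Blocks G.Edge) : ℕ :=
  G.numBoundary {v | P.block v ∈ K.vertexSet} K.edgeSet

/-- The total weight of the vertices of a subgraph of the packaging. -/
noncomputable def totalWeight (K : Graph P.Blocks G.Edge) : ℕ :=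
  ∑ᶠ b ∈ K.vertexSet, P.weight b

/-- Twice the genus parameter of a subgraph of the packaging, that is
`2 k(K) + e(K) - v(K) + ω(K) - f(K)`. It can be any integer. -/
noncomputable def twiceGenus (K : Graph P.Blocks G.Edge) : ℤ :=
  2 * (numComponents K : ℤ) + (K.edgeSet.ncard : ℤ) - (K.vertexSet.ncard : ℤ) +
    (totalWeight G P K : ℤ) - (numBoundaryOf G P K : ℤ)

end Tutte

/-- The variables of the packaged surface Tutte polynomial. For an integer `j`, `xg j` and `yg j`
stand for the variables with the half-integer index `j / 2`. -/
inductive TutteVar : Type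
  | x : TutteVar
  | y : TutteVar
  | xg : ℤ → TutteVar
  | yg : ℤ → TutteVar

open MvPolynomial in
/-- The packaged surface Tutte polynomial. The sum is over all sets of edges. The edges of the dual
are those of the ribbon graph, and its vertices are the boundary components. (The index types of
the sum and of the products are finite.) -/
noncomputable def tutte (G : PackagedRibbonGraph) : MvPolynomial TutteVar ℤ :=
  ∑ᶠ A : Set G.graph.Edge,
    X TutteVar.x ^ nullity (packaging G.graph.dual G.face Aᶜ) *
    X TutteVar.y ^ nullity (packaging G.graph G.vert A) *
    (∏ᶠ c : Components (packaging G.graph.dual G.face Aᶜ),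
      X (TutteVar.xg (twiceGenus G.graph.dual G.face (component _ c)))) *
    ∏ᶠ c : Components (packaging G.graph G.vert A),
      X (TutteVar.yg (twiceGenus G.graph G.vert (component _ c)))

/-! ### Deletion-contraction invariants -/

/-- The variables of the ring in which the universal invariant takes its values. -/
inductive UniVar : Type
  | α : UniVar
  | β : UniVar
  | κ : UniVar
  | τ : UniVar
  | a : ℤ → UniVar
  | b : ℤ → UniVar

open MvPolynomial UniVar in
/-- The four deletion-contraction relations, for every packaged ribbon graph and every edge, and the
values on the packaged ribbon graphs without edges. -/
structure IsUniversal (U : PackagedRibbonGraph → MvPolynomial UniVar ℤ) : Prop where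
  rel_one_one : ∀ (G : PackagedRibbonGraph) (d : G.graph.Dart), G.eta d = 1 → G.mu d = 1 →
    U G = X α * U (G.delete d) + X β * U (G.contract d)
  rel_one_two : ∀ (G : PackagedRibbonGraph) (d : G.graph.Dart), G.eta d = 1 → G.mu d = 2 →
    U G = X α * U (G.delete d) + X κ * U (G.contract d)
  rel_two_one : ∀ (G : PackagedRibbonGraph) (d : G.graph.Dart), G.eta d = 2 → G.mu d = 1 →
    U G = X τ * U (G.delete d) + X β * U (G.contract d)
  rel_two_two : ∀ (G : PackagedRibbonGraph) (d : G.graph.Dart), G.eta d = 2 → G.mu d = 2 →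
    U G = X τ * U (G.delete d) + X κ * U (G.contract d)
  edgeless : ∀ G : PackagedRibbonGraph, IsEmpty G.graph.Edge →
    U G = (∏ᶠ b : G.face.Blocks, X τ * X (a ((G.face.weight b : ℤ) - (G.face.size b : ℤ)))) *
      ∏ᶠ c : G.vert.Blocks, X κ * X (b ((G.vert.weight c : ℤ) - (G.vert.size c : ℤ)))

open MvPolynomial UniVar in
/-- The substitution `x = α`, `y = β`, `x_g = a_{2g - 1}`, `y_g = b_{2g - 1}`. -/
noncomputable def substitution : TutteVar → MvPolynomial UniVar ℤ
  | TutteVar.x => X α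
  | TutteVar.y => X β
  | TutteVar.xg j => X (a (j - 1))
  | TutteVar.yg j => X (b (j - 1))

end PackagedRibbon

namespace PackagedRibbon

/-! ### Counting images and cycles -/

/-! The invariant is the state sum itself: a sum over edge sets $A$ of a face factor `uniFace` times
a vertex factor `uniVert`, the prefactors $\tau^{|\mathcal F|}$ and $\kappa^{|\mathcal V|}$ being
absorbed into them. Fix an edge $e$. The sets $A$ without $e$ are the edge sets of the deletion, and
those with $e$ become the edge sets of the contraction when $e$ is dropped (`sum_set_split`). So the
recursion can be checked summand by summand.

Let $e\in A$. Contracting $e$ contracts an edge in the graph on the vertex blocks. If that edge is a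
loop, the nullity drops by one, which costs a factor $\beta$; otherwise the number of blocks drops
by one, which costs $\kappa$. The genus parameters stay: $e(K)$ drops by one, the weight rule raises
$\omega(K)-v(K)$ by one in both cases, and the boundary components of $\mathbb G|A$ survive. On the
face side $e$ is not an edge of the subgraph, and nothing changes. Deletion is the same with the two
sides exchanged, because $\mathbb G|A$ and $\mathbb G^*|A^c$ have the same boundary components
(`dual_bdry`).

Both factors are therefore instances of one structure `Side`, and `Side.Removal.term_eq_of_notMem`
and `Side.Removal.term_eq_of_mem` settle all four cases. Their input comes from `exists_removal`:
the boundary permutation has the form `ρ * flip (A \ {e})`, where the cycles of `ρ` bound the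
vertices after the removal, and removing $e$ takes its two ends out of all cycles. Cycles that
consist of these ends only become isolated vertices.

Uniqueness is an induction on the number of darts. Isomorphism invariance again compares summands;
the point is that reversing the orientation inverts the boundary permutation up to conjugation
(`sameCycle_bdry`). -/

theorem ncard_image_eq {α β α' β' : Type} {f : α → β} {g : α' → β'} (θ : α → α') {Y : Set α}
    {Z : Set α'} (hθ : θ '' Y = Z) (h : ∀ x ∈ Y, ∀ y ∈ Y, f x = f y ↔ g (θ x) = g (θ y)) :
    (f '' Y).ncard = (g '' Z).ncard := by
  subst hθ
  -- A value of `f` is transported through a chosen preimage. By `h` the choice does not matter, so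
  -- `θ` need not be injective.
  refine Set.ncard_congr (fun a ha => g (θ ha.choose)) ?_ ?_ ?_
  · intro a ha
    exact ⟨_, ⟨_, ha.choose_spec.1, rfl⟩, rfl⟩
  · intro a b ha hb hab
    have := (h _ ha.choose_spec.1 _ hb.choose_spec.1).2 hab
    rwa [ha.choose_spec.2, hb.choose_spec.2] at this
  · rintro _ ⟨_, ⟨x, hx, rfl⟩, rfl⟩
    have ha : f x ∈ f '' Y := ⟨x, hx, rfl⟩
    exact ⟨f x, ha, (h _ ha.choose_spec.1 _ hx).1 ha.choose_spec.2⟩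

section CycleLemmas

variable {X : Type} {p : Perm X}

theorem cyc_eq_iff {x y : X} : cyc p x = cyc p y ↔ p.SameCycle x y :=
  ⟨fun h => Quotient.exact h, fun h => Quotient.sound' h⟩

theorem cyc_apply (p : Perm X) (x : X) : cyc p (p x) = cyc p x :=
  cyc_eq_iff.2 (Perm.SameCycle.symm ⟨1, by simp⟩)

theorem exists_cyc (c : Cycles p) : ∃ x, cyc p x = c := Quotient.exists_rep c

theorem sameCycle_skip (p : Perm X) {a x y : X} (hx : x ≠ a) (hy : y ≠ a) :
    (skip p a).SameCycle x y ↔ p.SameCycle x y := by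
  classical
  constructor
  · intro h
    refine cyc_eq_iff.1 (sameCycle_invariant (f := cyc p) (fun z => ?_) h)
    rw [skip_invariant p a (cyc p) (cyc_apply p a), cyc_apply]
  · intro h
    -- Giving `a` the class of its successor makes the cycle map of `skip p a` constant along `p`.
    let g : X → Cycles (skip p a) := fun z => if z = a then cyc _ (p a) else cyc _ z
    have hg : ∀ z, g (p z) = g z := by
      intro z
      by_cases hz : z = a
      · subst hz
        by_cases h1 : p z = z
        · rw [h1]
        · simp [g]
      · by_cases h1 : p z = a
        · have : skip p a z = p a := by simp [skip, h1]
          simp only [g, h1, if_true, hz, if_false]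
          rw [← this, cyc_apply]
        · have h2 : p z ≠ p a := fun t => hz (p.injective t)
          have : skip p a z = p z := by simp [skip, swap_apply_of_ne_of_ne h1 h2]
          simp only [g, h1, if_false, hz]
          rw [← this, cyc_apply]
    have := sameCycle_invariant hg h
    simp only [g, hx, hy, if_false] at this
    exact cyc_eq_iff.1 this

theorem sameCycle_skipTwo (p : Perm X) (a b : X) (x y : {x : X // x ≠ a ∧ x ≠ b}) :
    (skipTwo p a b).SameCycle x y ↔ p.SameCycle x.1 y.1 := by
  unfold skipTwo
  rw [Perm.sameCycle_subtypePerm, sameCycle_skip _ x.2.2 y.2.2, sameCycle_skip _ x.2.1 y.2.1]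

/-- On a finite set the forward iterates of `x` exhaust its cycle, and they coincide for `p` and `q`
as long as they stay in `Z`. Cycles are thus local: what happens off `Z` is irrelevant. -/
theorem sameCycle_of_agree [Finite X] {p q : Perm X} {Z : Set X} (hpq : ∀ z ∈ Z, p z = q z) {x : X}
    (hZ : ∀ y, p.SameCycle x y → y ∈ Z) (y : X) : p.SameCycle x y ↔ q.SameCycle x y := by
  have h : ∀ n : ℕ, (p ^ n) x = (q ^ n) x := by
    intro n
    induction n with
    | zero => rfl
    | succ n ih =>
      rw [pow_succ', pow_succ', Perm.mul_apply, Perm.mul_apply, ← ih]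
      exact hpq _ (hZ _ ⟨n, by simp⟩)
  constructor
  · intro hy
    obtain ⟨n, rfl⟩ := hy.exists_nat_pow_eq
    exact ⟨n, by simp [h]⟩
  · intro hy
    obtain ⟨n, rfl⟩ := hy.exists_nat_pow_eq
    exact ⟨n, by simp [h]⟩

theorem sameCycle_involution (hp : ∀ x, p (p x) = x) {x y : X} :
    p.SameCycle x y ↔ y = x ∨ y = p x := by
  constructor
  · intro h
    have hf : ∀ z, (p z = x ∨ p z = p x) = (z = x ∨ z = p x) := by
      intro z
      have e1 : p z = x ↔ z = p x := ⟨fun t => by rw [← t, hp], fun t => by rw [t, hp]⟩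
      have e2 : p z = p x ↔ z = x := p.injective.eq_iff
      simp only [e1, e2, or_comm]
    exact (sameCycle_invariant (f := fun z => z = x ∨ z = p x) hf h).mp (Or.inl rfl)
  · rintro (rfl | rfl)
    · exact Perm.SameCycle.refl _ _
    · exact ⟨1, by simp⟩

theorem skipTwo_mul {p q : Perm X} {a b : X} (ha : q a = a) (hb : q b = b)
    (x : {x : X // x ≠ a ∧ x ≠ b}) (y : {x : X // x ≠ a ∧ x ≠ b}) (h : q x.1 = y.1) :
    skipTwo (p * q) a b x = skipTwo p a b y := by
  have h1 : ∀ (p : Perm X) {a : X}, q a = a → skip (p * q) a = skip p a * q := by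
    intro p a ha
    simp [skip, ha, mul_assoc]
  refine Subtype.ext ?_
  change skip (skip (p * q) a) b x.1 = skip (skip p a) b y.1
  rw [h1 p ha, h1 _ hb, Perm.mul_apply, h]

end CycleLemmas

/-! ### Quotients -/

/-- The inverse is induced by a section of `φ`; `h1` removes the dependence on the section, and `h3`
lifts relations back. The map `φ` may identify elements of one class, as happens when an edge is
contracted. -/
theorem exists_quot_equiv {B B' : Type} {r : B → B → Prop} {r' : B' → B' → Prop} (φ : B → B')
    (hs : Function.Surjective φ)
    (h1 : ∀ b c, φ b = φ c → Quot.mk r b = Quot.mk r c)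
    (h2 : ∀ b c, r b c → Quot.mk r' (φ b) = Quot.mk r' (φ c))
    (h3 : ∀ b' c', r' b' c' → ∃ b c, φ b = b' ∧ φ c = c' ∧ Quot.mk r b = Quot.mk r c) :
    ∃ Φ : Quot r ≃ Quot r', ∀ b, Φ (Quot.mk r b) = Quot.mk r' (φ b) := by
  have hσ : ∀ b, Quot.mk r (Function.surjInv hs (φ b)) = Quot.mk r b := fun b =>
    h1 _ _ (Function.surjInv_eq hs _)
  refine ⟨⟨Quot.lift (fun b => Quot.mk r' (φ b)) h2,
    Quot.lift (fun b' => Quot.mk r (Function.surjInv hs b')) ?_, ?_, ?_⟩, fun b => rfl⟩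
  · intro b' c' h'
    obtain ⟨b, c, rfl, rfl, h⟩ := h3 _ _ h'
    rw [hσ, hσ, h]
  · rintro ⟨b⟩
    exact hσ b
  · rintro ⟨b'⟩
    change Quot.mk r' (φ (Function.surjInv hs b')) = _
    rw [Function.surjInv_eq hs]

/-- A graph has at most as many vertices as edges and connected components together. -/
theorem card_le_card_add_card_quot {B : Type} [Finite B] (F : Finset (B × B)) :
    Nat.card B ≤ F.card + Nat.card (Quot fun b c : B => (b, c) ∈ F) := by
  classical
  induction F using Finset.induction_on with
  | empty =>
    rw [Finset.card_empty, zero_add]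
    refine Nat.card_le_card_of_injective (fun b : B => Quot.mk _ b) fun b c h => ?_
    exact congrArg (Quot.lift id fun _ _ h => absurd h (by simp)) h
  | insert e F he ih =>
    obtain ⟨x, y⟩ := e
    rw [Finset.card_insert_of_notMem he]
    refine ih.trans ?_
    have : Nat.card (Quot fun b c : B => (b, c) ∈ F) ≤
        Nat.card (Option (Quot fun b c : B => (b, c) ∈ insert (x, y) F)) := by
      let m : B → Quot fun b c : B => (b, c) ∈ F := fun b => Quot.mk _ b
      -- One more pair lowers the number of classes by at most one: the old classes are covered by
      -- the new ones, which avoid the class of `y` by sending it to that of `x`, and one extra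
      -- point for the class of `y`.
      let g : (Quot fun b c : B => (b, c) ∈ insert (x, y) F) → Quot fun b c : B => (b, c) ∈ F :=
        Quot.lift (fun b => if m b = m y then m x else m b) (by
          intro b c h
          rcases Finset.mem_insert.1 h with h | h
          · obtain ⟨rfl, rfl⟩ := Prod.mk.inj h
            simp
          · have : m b = m c := Quot.sound h
            simp only [this])
      refine Nat.card_le_card_of_surjective (fun o : Option _ => o.elim (m y) g) ?_
      rintro ⟨b⟩
      by_cases hb : m b = m y
      · exact ⟨none, hb.symm⟩
      · refine ⟨some (Quot.mk _ b), ?_⟩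
        exact if_neg hb
    rw [Finite.card_option] at this
    omega

/-! ### One side of a summand of the polynomial -/

/-- The data that determine the factors of a summand of the packaged surface Tutte polynomial that
come from the vertices: the involution of the darts, a permutation whose cycles are the boundary
components of a spanning ribbon subgraph, a set of edges, and the weighted blocks of the vertices
at the darts and of the isolated vertices. Replacing vertices by boundary components and the set of
edges by its complement gives the data of the geometric dual. -/
structure Side where
  D : Type
  I : Type
  B : Type
  [finite_D : Finite D]
  [finite_I : Finite I]
  [finite_B : Finite B]
  inv : Perm D
  bdry : Perm D
  S : Set (Cycles inv)
  blk : D → B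
  blkI : I → B
  w : B → ℕ

attribute [instance] Side.finite_D Side.finite_I Side.finite_B

namespace Side

variable (s s' : Side)

/-- The connected components of the graph on the blocks. -/
def Comp : Type := Quot fun b c : s.B => ∃ h, cyc s.inv h ∈ s.S ∧ b = s.blk h ∧ c = s.blk (s.inv h)

/-- The component of a block. -/
def comp (b : s.B) : s.Comp := Quot.mk _ b

instance : Finite s.Comp := inferInstanceAs (Finite (Quot _))

theorem comp_surjective : Function.Surjective s.comp := Quot.exists_rep

variable {s} in
theorem comp_inv {h : s.D} (hS : cyc s.inv h ∈ s.S) : s.comp (s.blk (s.inv h)) = s.comp (s.blk h) :=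
  (Quot.sound ⟨h, hS, rfl, rfl⟩).symm

/-- The edges of a component. -/
def edges (c : s.Comp) : Set (Cycles s.inv) :=
  cyc s.inv '' {h | cyc s.inv h ∈ s.S ∧ s.comp (s.blk h) = c}

/-- The number of boundary components of a component. -/
noncomputable def numBdry (c : s.Comp) : ℕ :=
  (cyc s.bdry '' {h | s.comp (s.blk h) = c}).ncard + {i | s.comp (s.blkI i) = c}.ncard

open Classical in
/-- The sum of the reduced weights of the blocks of a component. -/
noncomputable def reducedWeight (c : s.Comp) : ℤ :=
  ∑ᶠ b, if s.comp b = c then (s.w b : ℤ) - 1 else 0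

/-- Twice the genus parameter of a component. -/
noncomputable def genus (c : s.Comp) : ℤ :=
  2 + (s.edges c).ncard + s.reducedWeight c - s.numBdry c

/-- The nullity of the graph on the blocks. -/
noncomputable def null : ℕ := s.S.ncard + Nat.card s.Comp - Nat.card s.B

/-- The factors of a summand of the polynomial. -/
noncomputable def term {R : Type} [CommRing R] (Y : R) (yg : ℤ → R) : R :=
  Y ^ s.null * ∏ᶠ c, yg (s.genus c)

theorem term_eq {R : Type} [CommRing R] (Y : R) (yg : ℤ → R) (k : ℕ) (Φ : s.Comp ≃ s'.Comp)
    (hg : ∀ c, s.genus c = s'.genus (Φ c)) (hn : s.null = k + s'.null) :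
    s.term Y yg = Y ^ k * s'.term Y yg := by
  unfold term
  rw [hn, pow_add, mul_assoc]
  congr 2
  refine (finprod_congr fun c => by rw [hg c]).trans ?_
  exact finprod_comp_equiv Φ (f := fun c => yg (s'.genus c))

/-- This guarantees that the truncated subtraction in `null` cuts nothing off. -/
theorem card_le (hinv : ∀ h, s.inv (s.inv h) = h) :
    Nat.card s.B ≤ s.S.ncard + Nat.card s.Comp := by
  classical
  have hfin : s.S.Finite := Set.toFinite _
  -- One dart is chosen per edge, which bounds the number of pairs; `key` shows that the opposite
  -- dart gives the same identification.
  let F : Finset (s.B × s.B) := hfin.toFinset.image fun e =>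
    (s.blk (Quotient.out e), s.blk (s.inv (Quotient.out e)))
  have hF : F.card ≤ s.S.ncard := by
    rw [Set.ncard_eq_toFinset_card _ hfin]
    exact Finset.card_image_le
  refine (card_le_card_add_card_quot F).trans (add_le_add hF ?_)
  have key : ∀ h, cyc s.inv h ∈ s.S →
      (Quot.mk _ (s.blk h) : Quot fun b c : s.B => (b, c) ∈ F) = Quot.mk _ (s.blk (s.inv h)) := by
    intro h hS
    set k := Quotient.out (cyc s.inv h) with hk
    have h0 : cyc s.inv k = cyc s.inv h := Quotient.out_eq _
    have h1 : (Quot.mk _ (s.blk k) : Quot fun b c : s.B => (b, c) ∈ F) =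
        Quot.mk _ (s.blk (s.inv k)) :=
      Quot.sound (Finset.mem_image.2 ⟨_, hfin.mem_toFinset.2 hS, rfl⟩)
    have h2 : k = h ∨ k = s.inv h := (sameCycle_involution hinv).1 (cyc_eq_iff.1 h0).symm
    rcases h2 with h2 | h2
    · rwa [h2] at h1
    · rw [h2, hinv] at h1
      exact h1.symm
  refine Nat.card_le_card_of_surjective
    (Quot.lift (fun b => Quot.mk _ b) (by rintro _ _ ⟨h, hS, rfl, rfl⟩; exact key h hS)) ?_
  rintro ⟨b⟩
  exact ⟨s.comp b, rfl⟩

theorem exists_comp_equiv (φ : s.B → s'.B) (hs : Function.Surjective φ)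
    (h1 : ∀ b c, φ b = φ c → s.comp b = s.comp c)
    (h2 : ∀ h, cyc s.inv h ∈ s.S → s'.comp (φ (s.blk h)) = s'.comp (φ (s.blk (s.inv h))))
    (h3 : ∀ k, cyc s'.inv k ∈ s'.S → ∃ h, cyc s.inv h ∈ s.S ∧
      φ (s.blk h) = s'.blk k ∧ φ (s.blk (s.inv h)) = s'.blk (s'.inv k)) :
    ∃ Φ : s.Comp ≃ s'.Comp, ∀ b, Φ (s.comp b) = s'.comp (φ b) := by
  refine exists_quot_equiv φ hs h1 ?_ ?_
  · rintro _ _ ⟨h, hS, rfl, rfl⟩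
    exact h2 h hS
  · rintro _ _ ⟨k, hS, rfl, rfl⟩
    obtain ⟨h, hS, e1, e2⟩ := h3 k hS
    exact ⟨_, _, e1, e2, (comp_inv hS).symm⟩

end Side

/-- The constant `ε` is the gain when two blocks, possibly equal, are united. With constant
functions this counts blocks. With reduced weights the gain is 1 in both cases:
$(w_1+1)-1=(w_1-1)+1$ and $(w_1+w_2)-1=(w_1-1)+(w_2-1)+1$. -/
theorem sum_merge {B B' : Type} [Fintype B] [Fintype B'] {φ : B → B'}
    (hs : Function.Surjective φ) (b₁ b₂ : B)
    (hφ : ∀ b c, φ b = φ c ↔ b = c ∨ (b = b₁ ∨ b = b₂) ∧ (c = b₁ ∨ c = b₂))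
    (f : B' → ℤ) (g : B → ℤ) (ε : ℤ) (hf : ∀ b, b ≠ b₁ → b ≠ b₂ → f (φ b) = g b)
    (h1 : b₁ = b₂ → f (φ b₁) = g b₁ + ε) (h2 : b₁ ≠ b₂ → f (φ b₁) = g b₁ + g b₂ + ε) :
    ∑ b', f b' = ∑ b, g b + ε := by
  classical
  by_cases h : b₁ = b₂
  · subst h
    have hinj : Function.Injective φ := fun b c hbc => by
      rcases (hφ b c).1 hbc with h | ⟨h, h'⟩
      · exact h
      · rw [or_self] at h h'
        rw [h, h']
    rw [← Function.Bijective.sum_comp ⟨hinj, hs⟩ f, ← Finset.add_sum_erase _ _ (Finset.mem_univ b₁),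
      ← Finset.add_sum_erase _ g (Finset.mem_univ b₁), h1 rfl,
      Finset.sum_congr rfl fun b hb => hf b (Finset.ne_of_mem_erase hb) (Finset.ne_of_mem_erase hb)]
    ring
  · have e : ∑ b ∈ Finset.univ.erase b₂, f (φ b) = ∑ b', f b' := by
      refine Finset.sum_bij (fun b _ => φ b) (fun _ _ => Finset.mem_univ _) ?_ ?_ fun _ _ => rfl
      · intro b hb c hc hbc
        have hb := Finset.ne_of_mem_erase hb
        have hc := Finset.ne_of_mem_erase hc
        rcases (hφ b c).1 hbc with h | ⟨h | h, h' | h'⟩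
        · exact h
        · rw [h, h']
        · exact absurd h' hc
        · exact absurd h hb
        · exact absurd h hb
      · intro b' _
        obtain ⟨b, rfl⟩ := hs b'
        by_cases hb : b = b₂
        · refine ⟨b₁, by simp [h], ?_⟩
          exact (hφ _ _).2 (Or.inr ⟨Or.inl rfl, Or.inr hb⟩)
        · exact ⟨b, by simp [hb], rfl⟩
    have h1m : b₁ ∈ Finset.univ.erase b₂ := by simp [h]
    rw [← e, ← Finset.add_sum_erase _ _ h1m, ← Finset.add_sum_erase _ g (Finset.mem_univ b₂),
      ← Finset.add_sum_erase _ g h1m, h2 h, Finset.sum_congr rfl fun b hb =>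
        hf b (Finset.ne_of_mem_erase hb)
          (Finset.ne_of_mem_erase (Finset.mem_of_mem_erase hb))]
    ring

/-! ### The effect of removing an edge on the factors of a summand. -/

namespace Side

variable (s s' : Side)

/-- The data `s'` arise from `s` by the removal of the edge of `d`. The blocks may be united. A
boundary component that meets no other edge becomes an isolated vertex. -/
structure Removal (d : s.D) where
  inv_inv : ∀ h, s.inv (s.inv h) = h
  comp_bdry : ∀ h, s.comp (s.blk (s.bdry h)) = s.comp (s.blk h)
  φ : s.B → s'.B
  φ_surj : Function.Surjective φ
  ψ : s'.D → s.D
  ψ_inj : Function.Injective ψ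
  ψ_range : ∀ h, (∃ k, ψ k = h) ↔ h ≠ d ∧ h ≠ s.inv d
  ψ_inv : ∀ k, ψ (s'.inv k) = s.inv (ψ k)
  ψ_S : ∀ k, cyc s'.inv k ∈ s'.S ↔ cyc s.inv (ψ k) ∈ s.S
  ψ_bdry : ∀ h k, s'.bdry.SameCycle h k ↔ s.bdry.SameCycle (ψ h) (ψ k)
  ψ_blk : ∀ k, s'.blk k = φ (s.blk (ψ k))
  χ : s.I → s'.I
  χ_inj : Function.Injective χ
  χ_blk : ∀ i, s'.blkI (χ i) = φ (s.blkI i)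
  ι : {h // ∀ k, s.bdry.SameCycle h k → k = d ∨ k = s.inv d} → s'.I
  ι_eq : ∀ h k, ι h = ι k ↔ s.bdry.SameCycle h.1 k.1
  ι_blk : ∀ h, s'.blkI (ι h) = φ (s.blk h.1)
  χ_ne_ι : ∀ i h, χ i ≠ ι h
  cover : ∀ i', (∃ i, χ i = i') ∨ ∃ h, ι h = i'

namespace Removal

variable {s s'} {d : s.D} (r : s.Removal s' d)
include r

theorem inv_inv' (k : s'.D) : s'.inv (s'.inv k) = k :=
  r.ψ_inj (by rw [r.ψ_inv, r.ψ_inv, r.inv_inv])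

theorem cyc_inv_ne (k : s'.D) : cyc s.inv d ≠ cyc s.inv (r.ψ k) := fun h => by
  rcases (sameCycle_involution r.inv_inv).1 (cyc_eq_iff.1 h) with h | h
  · exact ((r.ψ_range _).1 ⟨k, rfl⟩).1 h
  · exact ((r.ψ_range _).1 ⟨k, rfl⟩).2 h

theorem cyc_inv_eq_or (h : s.D) : cyc s.inv d = cyc s.inv h ∨ ∃ k, r.ψ k = h := by
  by_cases h1 : ∃ k, r.ψ k = h
  · exact Or.inr h1
  · rw [r.ψ_range, not_and_or, not_not, not_not] at h1
    exact Or.inl (cyc_eq_iff.2 ((sameCycle_involution r.inv_inv).2 h1))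

theorem ncard_edges (Q : Set s.D) :
    (cyc s'.inv '' {k | cyc s'.inv k ∈ s'.S ∧ r.ψ k ∈ Q}).ncard =
      (cyc s.inv '' (r.ψ '' {k | cyc s.inv (r.ψ k) ∈ s.S ∧ r.ψ k ∈ Q})).ncard := by
  refine ncard_image_eq r.ψ ?_ fun h _ k _ => ?_
  · simp only [r.ψ_S]
  · rw [cyc_eq_iff, cyc_eq_iff, sameCycle_involution r.inv_inv, sameCycle_involution r.inv_inv',
      ← r.ψ_inv, r.ψ_inj.eq_iff, r.ψ_inj.eq_iff]

theorem exists_comp_equiv (h1 : ∀ b c, r.φ b = r.φ c → s.comp b = s.comp c)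
    (h2 : cyc s.inv d ∈ s.S → r.φ (s.blk d) = r.φ (s.blk (s.inv d))) :
    ∃ Φ : s.Comp ≃ s'.Comp, ∀ b, Φ (s.comp b) = s'.comp (r.φ b) := by
  refine Side.exists_comp_equiv s s' r.φ r.φ_surj h1 ?_ ?_
  · intro h hS
    by_cases hk : ∃ k, r.ψ k = h
    · obtain ⟨k, rfl⟩ := hk
      rw [← r.ψ_inv, ← r.ψ_blk, ← r.ψ_blk, comp_inv ((r.ψ_S k).2 hS)]
    · rw [r.ψ_range, not_and_or, not_not, not_not] at hk
      rcases hk with rfl | rfl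
      · rw [h2 hS]
      · rw [r.inv_inv, h2]
        rwa [cyc_apply] at hS
  · intro k hS
    exact ⟨r.ψ k, (r.ψ_S k).1 hS, (r.ψ_blk k).symm, by rw [← r.ψ_inv, ← r.ψ_blk]⟩

/-- A boundary cycle that meets a surviving dart remains a boundary cycle. One that consists of ends
of the removed edge only turns into an isolated vertex, so it passes from one summand of `numBdry`
to the other and the total is kept. -/
theorem numBdry_eq (Φ : s.Comp ≃ s'.Comp) (hΦ : ∀ b, Φ (s.comp b) = s'.comp (r.φ b)) (c : s.Comp) :
    s.numBdry c = s'.numBdry (Φ c) := by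
  have hc : ∀ h k, s.bdry.SameCycle h k → s.comp (s.blk h) = s.comp (s.blk k) :=
    fun h k => sameCycle_invariant (f := fun h => s.comp (s.blk h)) r.comp_bdry
  let small : s.D → Prop := fun h => ∀ k, s.bdry.SameCycle h k → k = d ∨ k = s.inv d
  have e1 : cyc s.bdry '' {h | s.comp (s.blk h) = c} =
      cyc s.bdry '' (r.ψ '' {k | s'.comp (s'.blk k) = Φ c}) ∪
        cyc s.bdry '' {h | small h ∧ s.comp (s.blk h) = c} := by
    ext e
    constructor
    · rintro ⟨h, hh, rfl⟩
      by_cases hk : small h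
      · exact Or.inr ⟨h, ⟨hk, hh⟩, rfl⟩
      · simp only [small, not_forall, not_or, exists_prop] at hk
        obtain ⟨k, hk, hk'⟩ := hk
        obtain ⟨k, rfl⟩ := (r.ψ_range k).2 hk'
        refine Or.inl ⟨_, ⟨k, ?_, rfl⟩, (cyc_eq_iff.2 hk).symm⟩
        change s'.comp (s'.blk k) = Φ c
        rw [r.ψ_blk, ← hΦ, ← hc _ _ hk]
        exact congrArg Φ hh
    · rintro (⟨_, ⟨k, hk, rfl⟩, rfl⟩ | ⟨h, hh, rfl⟩)
      · refine ⟨_, ?_, rfl⟩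
        change s'.comp (s'.blk k) = Φ c at hk
        rw [r.ψ_blk, ← hΦ] at hk
        exact Φ.injective hk
      · exact ⟨h, hh.2, rfl⟩
  have e2 : Disjoint (cyc s.bdry '' (r.ψ '' {k | s'.comp (s'.blk k) = Φ c}))
      (cyc s.bdry '' {h | small h ∧ s.comp (s.blk h) = c}) := by
    rw [Set.disjoint_left]
    rintro _ ⟨_, ⟨k, -, rfl⟩, rfl⟩ ⟨h, ⟨hh, -⟩, e⟩
    have := hh _ (cyc_eq_iff.1 e)
    have h3 := (r.ψ_range _).1 ⟨k, rfl⟩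
    tauto
  have e3 : {i | s'.comp (s'.blkI i) = Φ c} = r.χ '' {i | s.comp (s.blkI i) = c} ∪
      r.ι '' {h | s.comp (s.blk h.1) = c} := by
    ext i
    constructor
    · intro hi
      change _ = _ at hi
      rcases r.cover i with ⟨i, rfl⟩ | ⟨h, rfl⟩
      · rw [r.χ_blk, ← hΦ] at hi
        exact Or.inl ⟨i, Φ.injective hi, rfl⟩
      · rw [r.ι_blk, ← hΦ] at hi
        exact Or.inr ⟨h, Φ.injective hi, rfl⟩
    · rintro (⟨i, hi, rfl⟩ | ⟨h, hh, rfl⟩)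
      · change s'.comp _ = _
        rw [r.χ_blk, ← hΦ]
        exact congrArg Φ hi
      · change s'.comp _ = _
        rw [r.ι_blk, ← hΦ]
        exact congrArg Φ hh
  have e4 : Disjoint (r.χ '' {i | s.comp (s.blkI i) = c}) (r.ι '' {h | s.comp (s.blk h.1) = c}) := by
    rw [Set.disjoint_left]
    rintro _ ⟨i, -, rfl⟩ ⟨h, -, e⟩
    exact r.χ_ne_ι i h e.symm
  have e5 : (cyc s'.bdry '' {k | s'.comp (s'.blk k) = Φ c}).ncard =
      (cyc s.bdry '' (r.ψ '' {k | s'.comp (s'.blk k) = Φ c})).ncard :=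
    ncard_image_eq r.ψ rfl fun h _ k _ => by rw [cyc_eq_iff, cyc_eq_iff, r.ψ_bdry]
  have e6 : (r.ι '' {h | s.comp (s.blk h.1) = c}).ncard =
      (cyc s.bdry '' {h | small h ∧ s.comp (s.blk h) = c}).ncard := by
    refine ncard_image_eq Subtype.val ?_ fun h _ k _ => by rw [cyc_eq_iff, r.ι_eq]
    ext h
    constructor
    · rintro ⟨h, hh, rfl⟩
      exact ⟨h.2, hh⟩
    · rintro ⟨h1, h2⟩
      exact ⟨⟨h, h1⟩, h2, rfl⟩
  unfold numBdry
  rw [e1, e3, Set.ncard_union_eq e2 (Set.toFinite _) (Set.toFinite _), Set.ncard_union_eq e4, e5, e6,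
    Set.ncard_image_of_injective _ r.χ_inj]
  omega

theorem S_eq : s'.S = cyc s'.inv '' {k | cyc s'.inv k ∈ s'.S ∧ r.ψ k ∈ Set.univ} := by
  ext e
  obtain ⟨k, rfl⟩ := exists_cyc e
  exact ⟨fun h => ⟨k, ⟨h, trivial⟩, rfl⟩, fun ⟨k, h, e⟩ => e ▸ h.1⟩

theorem edges_eq (Φ : s.Comp ≃ s'.Comp) (hΦ : ∀ b, Φ (s.comp b) = s'.comp (r.φ b)) (c : s.Comp) :
    s'.edges (Φ c) =
      cyc s'.inv '' {k | cyc s'.inv k ∈ s'.S ∧ r.ψ k ∈ {h | s.comp (s.blk h) = c}} := by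
  unfold edges
  congr 1
  ext k
  simp only [Set.mem_ofPred_eq, r.ψ_blk, ← hΦ, Φ.injective.eq_iff]

-- The removed edge is not an edge of the graph on the blocks, so that graph and its weights are
-- unchanged; the boundary count is `numBdry_eq`.
open Classical in
theorem term_eq_of_notMem {R : Type} [CommRing R] (Y : R) (yg : ℤ → R) (hd : cyc s.inv d ∉ s.S)
    (hφ : Function.Injective r.φ) (hw : ∀ b, s'.w (r.φ b) = s.w b) :
    s.term Y yg = s'.term Y yg := by
  obtain ⟨Φ, hΦ⟩ := r.exists_comp_equiv (fun b c h => by rw [hφ h]) (fun h => absurd h hd)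
  have key : ∀ Q : Set s.D, cyc s.inv '' (r.ψ '' {k | cyc s.inv (r.ψ k) ∈ s.S ∧ r.ψ k ∈ Q}) =
      cyc s.inv '' {h | cyc s.inv h ∈ s.S ∧ h ∈ Q} := by
    intro Q
    ext e
    constructor
    · rintro ⟨_, ⟨k, hk, rfl⟩, rfl⟩
      exact ⟨_, hk, rfl⟩
    · rintro ⟨h, hh, rfl⟩
      rcases r.cyc_inv_eq_or h with h1 | ⟨k, rfl⟩
      · rw [h1] at hd
        exact absurd hh.1 hd
      · exact ⟨_, ⟨k, hh, rfl⟩, rfl⟩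
  have hB : Nat.card s.B = Nat.card s'.B := Nat.card_congr (Equiv.ofBijective r.φ ⟨hφ, r.φ_surj⟩)
  have hS : s.S.ncard = s'.S.ncard := by
    rw [r.S_eq, r.ncard_edges, key]
    congr 1
    ext e
    obtain ⟨k, rfl⟩ := exists_cyc e
    exact ⟨fun h => ⟨k, ⟨h, trivial⟩, rfl⟩, fun ⟨k, h, e⟩ => e ▸ h.1⟩
  rw [term_eq s s' Y yg 0 Φ ?_ ?_, pow_zero, one_mul]
  · intro c
    have h1 : s.reducedWeight c = s'.reducedWeight (Φ c) := by
      unfold reducedWeight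
      rw [← finsum_comp_equiv (Equiv.ofBijective r.φ ⟨hφ, r.φ_surj⟩)
        (f := fun b' => if s'.comp b' = Φ c then (s'.w b' : ℤ) - 1 else 0)]
      refine finsum_congr fun b => ?_
      change _ = if s'.comp (r.φ b) = Φ c then (s'.w (r.φ b) : ℤ) - 1 else 0
      simp only [← hΦ, Φ.injective.eq_iff, hw]
    unfold genus
    rw [r.numBdry_eq Φ hΦ, h1, r.edges_eq Φ hΦ, r.ncard_edges, key]
    rfl
  · unfold null
    rw [hB, hS, Nat.card_congr Φ, zero_add]

-- The graph on the blocks undergoes the contraction of an edge. A loop costs one in the nullity,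
-- any other edge costs one block. In the genus the lost edge is made up for by the reduced weight.
open Classical in
theorem term_eq_of_mem {R : Type} [CommRing R] (Y : R) (yg : ℤ → R) (hd : cyc s.inv d ∈ s.S)
    (hφ : ∀ b c, r.φ b = r.φ c ↔ b = c ∨
      (b = s.blk d ∨ b = s.blk (s.inv d)) ∧ (c = s.blk d ∨ c = s.blk (s.inv d)))
    (hw : ∀ b, b ≠ s.blk d → b ≠ s.blk (s.inv d) → s'.w (r.φ b) = s.w b)
    (hw₁ : s.blk d = s.blk (s.inv d) → s'.w (r.φ (s.blk d)) = s.w (s.blk d) + 1)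
    (hw₂ : s.blk d ≠ s.blk (s.inv d) →
      s'.w (r.φ (s.blk d)) = s.w (s.blk d) + s.w (s.blk (s.inv d))) :
    s.term Y yg = Y ^ (if s.blk d = s.blk (s.inv d) then 1 else 0) * s'.term Y yg ∧
      Nat.card s.B = Nat.card s'.B + (if s.blk d = s.blk (s.inv d) then 0 else 1) := by
  have hdc : s.comp (s.blk (s.inv d)) = s.comp (s.blk d) := comp_inv hd
  obtain ⟨Φ, hΦ⟩ := r.exists_comp_equiv (fun b c h => by
    rcases (hφ b c).1 h with rfl | ⟨rfl | rfl, rfl | rfl⟩ <;> simp only [hdc])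
    (fun _ => (hφ _ _).2 (Or.inr ⟨Or.inl rfl, Or.inr rfl⟩))
  -- Here `Q` will be the set of all darts or of the darts in one component. The hypothesis prevents
  -- the removed edge from meeting `Q` at `s.inv d` only.
  have key : ∀ Q : Set s.D, (∀ h ∈ Q, cyc s.inv d = cyc s.inv h → d ∈ Q) →
      (cyc s.inv '' {h | cyc s.inv h ∈ s.S ∧ h ∈ Q}).ncard =
        (cyc s'.inv '' {k | cyc s'.inv k ∈ s'.S ∧ r.ψ k ∈ Q}).ncard + if d ∈ Q then 1 else 0 := by
    intro Q hQ
    rw [r.ncard_edges]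
    have hn : cyc s.inv d ∉ cyc s.inv '' (r.ψ '' {k | cyc s.inv (r.ψ k) ∈ s.S ∧ r.ψ k ∈ Q}) := by
      rintro ⟨_, ⟨k, -, rfl⟩, e⟩
      exact r.cyc_inv_ne k e.symm
    split_ifs with hdQ
    · rw [← Set.ncard_insert_of_notMem hn (Set.toFinite _)]
      congr 1
      ext e
      constructor
      · rintro ⟨h, hh, rfl⟩
        rcases r.cyc_inv_eq_or h with h1 | ⟨k, rfl⟩
        · exact Or.inl h1.symm
        · exact Or.inr ⟨_, ⟨k, hh, rfl⟩, rfl⟩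
      · rintro (rfl | ⟨_, ⟨k, hk, rfl⟩, rfl⟩)
        · exact ⟨d, ⟨hd, hdQ⟩, rfl⟩
        · exact ⟨_, hk, rfl⟩
    · rw [add_zero]
      congr 1
      ext e
      constructor
      · rintro ⟨h, hh, rfl⟩
        rcases r.cyc_inv_eq_or h with h1 | ⟨k, rfl⟩
        · exact absurd (hQ h hh.2 h1) hdQ
        · exact ⟨_, ⟨k, hh, rfl⟩, rfl⟩
      · rintro ⟨_, ⟨k, hk, rfl⟩, rfl⟩
        exact ⟨_, hk, rfl⟩
  let _ := Fintype.ofFinite s.B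
  let _ := Fintype.ofFinite s'.B
  -- Counting blocks is the case of constant functions, where uniting two different blocks gains
  -- $-1$.
  have hB : Nat.card s.B = Nat.card s'.B + (if s.blk d = s.blk (s.inv d) then 0 else 1) := by
    have := sum_merge r.φ_surj _ _ hφ (fun _ => 1) (fun _ => 1)
      (if s.blk d = s.blk (s.inv d) then 0 else -1) (fun _ _ _ => rfl) (fun h => by simp [h])
      (fun h => by simp [h])
    simp only [Finset.sum_const, Finset.card_univ, nsmul_eq_mul, mul_one] at this
    rw [Nat.card_eq_fintype_card, Nat.card_eq_fintype_card]
    split_ifs at this ⊢ <;> omega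
  have hS : s.S.ncard = s'.S.ncard + 1 := by
    have := key Set.univ (fun _ _ _ => trivial)
    rw [← r.S_eq, if_pos (Set.mem_univ d)] at this
    rw [← this]
    congr 1
    ext e
    obtain ⟨k, rfl⟩ := exists_cyc e
    exact ⟨fun h => ⟨k, ⟨h, trivial⟩, rfl⟩, fun ⟨k, h, e⟩ => e ▸ h.1⟩
  refine ⟨term_eq s s' Y yg _ Φ ?_ ?_, hB⟩
  · intro c
    have h1 : s'.reducedWeight (Φ c) =
        s.reducedWeight c + if s.comp (s.blk d) = c then 1 else 0 := by
      unfold reducedWeight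
      rw [finsum_eq_sum_of_fintype, finsum_eq_sum_of_fintype]
      refine sum_merge r.φ_surj _ _ hφ _ _ _ ?_ ?_ ?_
      · intro b h1 h2
        simp only [← hΦ, Φ.injective.eq_iff, hw b h1 h2]
      · intro h
        simp only [← hΦ, Φ.injective.eq_iff, hw₁ h]
        split_ifs <;> simp
      · intro h
        simp only [← hΦ, Φ.injective.eq_iff, hw₂ h, hdc]
        split_ifs
        · push_cast
          ring
        · simp
    have h2 : (s.edges c).ncard =
        (s'.edges (Φ c)).ncard + if s.comp (s.blk d) = c then 1 else 0 := by
      rw [r.edges_eq Φ hΦ]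
      refine key {h | s.comp (s.blk h) = c} fun h hh e => ?_
      change s.comp (s.blk h) = c at hh
      change s.comp (s.blk d) = c
      rcases (sameCycle_involution r.inv_inv).1 (cyc_eq_iff.1 e) with rfl | rfl
      · exact hh
      · rwa [← hdc]
    unfold genus
    rw [r.numBdry_eq Φ hΦ, h1, h2]
    split_ifs <;> push_cast <;> ring
  -- In the loop case the drop of the nullity would be lost if the subtraction for `s'` were
  -- truncated.
  · have := s'.card_le r.inv_inv'
    unfold null
    rw [Nat.card_congr Φ]
    split_ifs at hB ⊢ <;> omega

end Removal

end Side

/-! ### The sides of a packaged ribbon graph -/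

namespace RibbonGraph

variable (G : RibbonGraph)

theorem flip_of_mem {A : Set G.Edge} {h : G.Dart} (hA : G.edgeOf h ∈ A) : G.flip A h = G.inv h :=
  if_pos hA

theorem flip_of_notMem {A : Set G.Edge} {h : G.Dart} (hA : G.edgeOf h ∉ A) : G.flip A h = h :=
  if_neg hA

theorem flip_flip (A : Set G.Edge) (h : G.Dart) : G.flip A (G.flip A h) = h :=
  Function.Involutive.toPerm_involutive _ h

theorem edgeOf_inv (h : G.Dart) : G.edgeOf (G.inv h) = G.edgeOf h := cyc_apply _ _

/-- The data of the spanning ribbon subgraph with edge set `A`. -/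
noncomputable def side (P : WeightedPartition G.Vertex) (A : Set G.Edge) : Side where
  D := G.Dart
  I := G.Isolated
  B := P.Blocks
  inv := G.inv
  bdry := G.rot * G.flip A
  S := A
  blk h := P.block (G.vertexOf h)
  blkI i := P.block (Sum.inr i)
  w := P.weight

variable {G}

/-- A boundary curve moves around a vertex or along an edge of `A`, and the ends of such an edge lie
in one component. Hence every boundary cycle belongs to a single component. -/
theorem side_comp_bdry (P : WeightedPartition G.Vertex) (A : Set G.Edge) (h : G.Dart) :
    (G.side P A).comp ((G.side P A).blk ((G.side P A).bdry h)) =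
      (G.side P A).comp ((G.side P A).blk h) := by
  have h1 : (G.side P A).blk ((G.side P A).bdry h) = (G.side P A).blk (G.flip A h) :=
    congrArg P.block (G.rot_vertexOf (G.flip A h))
  rw [h1]
  by_cases hA : G.edgeOf h ∈ A
  · rw [flip_of_mem G hA]
    exact Side.comp_inv (s := G.side P A) hA
  · rw [flip_of_notMem G hA]

theorem exists_components_equiv (P : WeightedPartition G.Vertex) (A : Set G.Edge) :
    ∃ Φ : Components (packaging G P A) ≃ (G.side P A).Comp,
      ∀ b, Φ (Quot.mk _ b) = (G.side P A).comp b.1 := by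
  refine exists_quot_equiv (fun b : (packaging G P A).vertexSet => b.1) (fun b => ⟨⟨b, Set.mem_univ _⟩, rfl⟩) ?_ ?_ ?_
  · intro b c h
    rw [Subtype.ext h]
  · rintro ⟨b, hb⟩ ⟨c, hc⟩ ⟨_, hA, h, rfl, rfl, rfl⟩
    exact Quot.sound ⟨h, hA, rfl, rfl⟩
  · rintro _ _ ⟨h, hA, rfl, rfl⟩
    exact ⟨⟨_, Set.mem_univ _⟩, ⟨_, Set.mem_univ _⟩, rfl, rfl,
      Quot.sound ⟨_, hA, h, rfl, rfl, rfl⟩⟩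

end RibbonGraph

theorem numComponents_component {W D : Type} (K : Graph W D) (c : Components K) :
    numComponents (component K c) = 1 := by
  obtain ⟨⟨x, hx⟩, rfl⟩ := Quot.exists_rep c
  have hx' : x ∈ (component K (Quot.mk _ ⟨x, hx⟩)).vertexSet := ⟨hx, rfl⟩
  refine Nat.card_eq_one_iff_unique.2 ⟨⟨?_⟩, ⟨Quot.mk _ ⟨x, hx'⟩⟩⟩
  suffices h : ∀ q : Components (component K (Quot.mk _ ⟨x, hx⟩)), q = Quot.mk _ ⟨x, hx'⟩ from
    fun q q' => (h q).trans (h q').symm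
  rintro ⟨y, hy, hyx⟩
  -- Being joined to `x` inside the component is invariant under adjacency in `K`, so it descends to
  -- the components of `K` and holds on all of the class of `x`.
  let f : Components K → Prop := Quot.lift (fun z => ∃ hz : z.1 ∈
      (component K (Quot.mk _ ⟨x, hx⟩)).vertexSet,
      (Quot.mk _ ⟨z.1, hz⟩ : Components (component K (Quot.mk _ ⟨x, hx⟩))) = Quot.mk _ ⟨x, hx'⟩) (by
    have key : ∀ z z' : K.vertexSet, K.Adj z z' → (∃ hz : z.1 ∈
        (component K (Quot.mk _ ⟨x, hx⟩)).vertexSet,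
        (Quot.mk _ ⟨z.1, hz⟩ : Components (component K (Quot.mk _ ⟨x, hx⟩))) = Quot.mk _ ⟨x, hx'⟩) →
        (∃ hz : z'.1 ∈ (component K (Quot.mk _ ⟨x, hx⟩)).vertexSet,
        (Quot.mk _ ⟨z'.1, hz⟩ : Components (component K (Quot.mk _ ⟨x, hx⟩))) =
          Quot.mk _ ⟨x, hx'⟩) := by
      rintro z z' hzz' ⟨hz, h⟩
      have hz2 := hz.choose_spec
      have hz' : z'.1 ∈ (component K (Quot.mk _ ⟨x, hx⟩)).vertexSet :=
        ⟨z'.2, (Quot.sound (r := fun x y : K.vertexSet => K.Adj x y) hzz').symm.trans hz2⟩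
      refine ⟨hz', Eq.trans (Quot.sound ?_) h⟩
      obtain ⟨e, he⟩ := hzz'.symm
      exact ⟨e, he, hz', hz⟩
    intro z z' hzz'
    exact propext ⟨key z z' hzz', key z' z hzz'.symm⟩)
  have h1 : f (Quot.mk _ ⟨y, hy⟩) := by
    rw [hyx]
    exact ⟨hx', rfl⟩
  exact h1.choose_spec

namespace RibbonGraph

variable {G : RibbonGraph}

/-- A component has $k=1$, whence the constant 2 in `Side.genus`, and reduced weights add up to
$\omega-v$. The boundary of the component is defined by its own edges, that of the side by all of
`A`; the two permutations agree at the darts of the component, which suffices by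
`sameCycle_of_agree`. -/
theorem twiceGenus_component (P : WeightedPartition G.Vertex) (A : Set G.Edge)
    (Φ : Components (packaging G P A) ≃ (G.side P A).Comp)
    (hΦ : ∀ b, Φ (Quot.mk _ b) = (G.side P A).comp b.1) (c : Components (packaging G P A)) :
    twiceGenus G P (component _ c) = (G.side P A).genus (Φ c) := by
  classical
  have hV : ∀ b : P.Blocks, b ∈ (component _ c).vertexSet ↔ (G.side P A).comp b = Φ c := by
    intro b
    have := hΦ ⟨b, Set.mem_univ _⟩
    constructor
    · rintro ⟨_, rfl⟩
      exact this.symm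
    · intro h
      exact ⟨Set.mem_univ _, Φ.injective (this.trans h)⟩
  have hE : (component _ c).edgeSet = (G.side P A).edges (Φ c) := by
    ext e
    constructor
    · rintro ⟨x, y, ⟨hA, h, rfl, rfl, rfl⟩, hx, -⟩
      exact ⟨h, ⟨hA, (hV _).1 hx⟩, rfl⟩
    · rintro ⟨h, ⟨hA, hc⟩, rfl⟩
      refine ⟨_, _, ⟨hA, h, rfl, rfl, rfl⟩, (hV _).2 hc, (hV _).2 ?_⟩
      rw [← hc]
      exact Side.comp_inv (s := G.side P A) hA
  have hX : ∀ h k, (G.side P A).bdry.SameCycle h k →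
      (G.side P A).comp ((G.side P A).blk h) = (G.side P A).comp ((G.side P A).blk k) :=
    fun h k => sameCycle_invariant (f := fun h => (G.side P A).comp ((G.side P A).blk h))
      (side_comp_bdry P A)
  have hF : numBoundaryOf G P (component _ c) = (G.side P A).numBdry (Φ c) := by
    unfold numBoundaryOf numBoundary Side.numBdry
    congr 1
    · have h1 : {e : Cycles (G.rot * G.flip (component _ c).edgeSet) | ∃ h, G.vertexOf h ∈
          {v | P.block v ∈ (component _ c).vertexSet} ∧ cyc _ h = e} =
          cyc _ '' {h | (G.side P A).comp ((G.side P A).blk h) = Φ c} := by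
        ext e
        refine exists_congr fun h => and_congr_left fun _ => ?_
        exact hV _
      rw [h1]
      refine (ncard_image_eq id (Set.image_id _) fun h hh k _ => ?_).symm
      refine cyc_eq_iff.trans (Iff.trans ?_ cyc_eq_iff.symm)
      refine sameCycle_of_agree (Z := {h | (G.side P A).comp ((G.side P A).blk h) = Φ c}) ?_ ?_ k
      · intro z hz
        have hz' : G.edgeOf z ∈ (component _ c).edgeSet ↔ G.edgeOf z ∈ A := by
          rw [hE]
          constructor
          · rintro ⟨k, ⟨hk, -⟩, e⟩
            exact e ▸ hk
          · intro hA
            exact ⟨z, ⟨hA, hz⟩, rfl⟩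
        change G.rot (G.flip A z) = G.rot (G.flip _ z)
        congr 1
        by_cases hA : G.edgeOf z ∈ A
        · rw [flip_of_mem G hA, flip_of_mem G (hz'.2 hA)]
        · rw [flip_of_notMem G hA, flip_of_notMem G (fun h => hA (hz'.1 h))]
      · intro y hy
        exact (hX _ _ hy).symm.trans hh
    · congr 1
      ext i
      exact hV _
  have hW : (totalWeight G P (component _ c) : ℤ) - ((component _ c).vertexSet.ncard : ℤ) =
      (G.side P A).reducedWeight (Φ c) := by
    let _ := Fintype.ofFinite P.Blocks
    let _ : Fintype (G.side P A).B := Fintype.ofFinite P.Blocks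
    have hs : (component _ c).vertexSet =
        ((Finset.univ.filter fun b : P.Blocks => (G.side P A).comp b = Φ c : Finset P.Blocks) :
          Set P.Blocks) := by
      ext b
      simp [hV]
    unfold totalWeight Side.reducedWeight
    rw [hs, finsum_mem_coe_finset, Set.ncard_coe_finset, finsum_eq_sum_of_fintype,
      ← Finset.sum_filter, Finset.sum_sub_distrib]
    simp only [Finset.sum_const, nsmul_eq_mul, mul_one, Nat.cast_sum]
    rfl
  have hE' : (component _ c).edgeSet.ncard = ((G.side P A).edges (Φ c)).ncard :=
    congrArg Set.ncard hE
  unfold twiceGenus Side.genus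
  rw [numComponents_component, ← hW, hF, hE']
  push_cast
  ring

theorem side_term {R : Type} [CommRing R] (P : WeightedPartition G.Vertex) (A : Set G.Edge) (Y : R)
    (yg : ℤ → R) :
    Y ^ nullity (packaging G P A) *
      ∏ᶠ c : Components (packaging G P A), yg (twiceGenus G P (component _ c)) =
    (G.side P A).term Y yg := by
  obtain ⟨Φ, hΦ⟩ := exists_components_equiv P A
  unfold Side.term
  congr 1
  · congr 1
    unfold nullity numComponents Side.null
    rw [Nat.card_congr Φ]
    congr 1
    exact Set.ncard_univ _
  · rw [← finprod_comp_equiv Φ (f := fun c => yg ((G.side P A).genus c))]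
    exact finprod_congr fun c => by rw [twiceGenus_component P A Φ hΦ]

/-- Following all edges and then undoing those of the complement leaves the flip of `A`: in
permutations, `G.inv * flip Aᶜ = flip A`. -/
theorem dual_bdry (A : Set G.Edge) (P : WeightedPartition G.dual.Vertex) :
    (G.dual.side P Aᶜ).bdry = G.rot * G.flip A := by
  ext h
  change G.rot (G.inv (G.dual.flip Aᶜ h)) = G.rot (G.flip A h)
  congr 1
  by_cases hA : G.edgeOf h ∈ A
  · rw [flip_of_mem G hA]
    exact congrArg G.inv (flip_of_notMem G.dual (A := Aᶜ) fun h' => h' hA)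
  · rw [flip_of_notMem G hA]
    exact (congrArg G.inv (flip_of_mem G.dual (A := Aᶜ) hA)).trans (G.inv_inv h)

end RibbonGraph

/-! ### Removing an edge -/

theorem sameCycle_invariant_on {X B : Type} [Finite X] {p : Perm X} {f : X → B} {Z : Set X}
    (hf : ∀ z ∈ Z, f (p z) = f z) {x y : X} (hZ : ∀ y, p.SameCycle x y → y ∈ Z)
    (h : p.SameCycle x y) : f y = f x := by
  obtain ⟨n, rfl⟩ := h.exists_nat_pow_eq
  clear h
  induction n with
  | zero => rfl
  | succ n ih =>
    rw [pow_succ', Perm.mul_apply, hf _ (hZ _ ⟨n, by simp⟩), ih]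

/-- The value of `f` is carried along the cycle of `x` while the cycle stays in `Z`. For the two
ends of a removed edge this means that a block keeps a surviving dart or acquires a new isolated
vertex. -/
theorem exists_first_notMem {X B : Type} [Finite X] {p : Perm X} {f : X → B} {Z : Set X}
    (hf : ∀ z ∈ Z, f (p z) = f z) (x : X) :
    (∃ k, k ∉ Z ∧ f k = f x) ∨ ∀ y, p.SameCycle x y → y ∈ Z := by
  by_cases hk : ∃ k, k ∉ Z ∧ f k = f x
  · exact Or.inl hk
  · right
    push Not at hk
    intro y hy
    obtain ⟨n, rfl⟩ := hy.exists_nat_pow_eq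
    clear hy
    have : (p ^ n) x ∈ Z ∧ f ((p ^ n) x) = f x := by
      induction n with
      | zero => exact ⟨by_contra fun h => hk _ h rfl, rfl⟩
      | succ n ih =>
        have h1 : f ((p ^ (n + 1)) x) = f x := by
          rw [pow_succ', Perm.mul_apply, hf _ ih.1, ih.2]
        exact ⟨by_contra fun h => hk _ h h1, h1⟩
    exact this.1

namespace RibbonGraph

variable (G : RibbonGraph)

/-- The flip without the removed edge fixes both of its ends, so taking them out commutes with it
(`skipTwo_mul`). -/
theorem removeEdge_bdry (d : G.Dart) (ρ : Perm G.Dart) (A : Set G.Edge)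
    (A' : Set (G.removeEdge d ρ).Edge)
    (hA : ∀ k : (G.removeEdge d ρ).Dart, (G.removeEdge d ρ).edgeOf k ∈ A' ↔ G.edgeOf k.1 ∈ A) :
    (G.removeEdge d ρ).rot * (G.removeEdge d ρ).flip A' =
      skipTwo (ρ * G.flip (A \ {G.edgeOf d})) d (G.inv d) := by
  ext x
  refine (skipTwo_mul ?_ ?_ x ((G.removeEdge d ρ).flip A' x) ?_).symm
  · exact flip_of_notMem G fun h => h.2 rfl
  · exact flip_of_notMem G fun h => h.2 (G.edgeOf_inv d)
  · have hx : G.edgeOf x.1 ≠ G.edgeOf d := fun h => by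
      rcases (sameCycle_involution G.inv_inv).1 (cyc_eq_iff.1 h.symm) with h | h
      · exact x.2.1 h
      · exact x.2.2 h
    by_cases h : G.edgeOf x.1 ∈ A
    · rw [flip_of_mem G (A := A \ {G.edgeOf d}) ⟨h, hx⟩, flip_of_mem _ ((hA x).2 h)]
      rfl
    · rw [flip_of_notMem G (A := A \ {G.edgeOf d}) fun h' => h h'.1,
        flip_of_notMem _ fun h' => h ((hA x).1 h')]

/-- The transposition in `curves` is exactly the part of the flip that belongs to the edge of `d`.
-/
theorem rot_mul_flip_of_mem (d : G.Dart) {A : Set G.Edge} (hd : G.edgeOf d ∈ A) :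
    G.rot * G.flip A = G.curves d * G.flip (A \ {G.edgeOf d}) := by
  ext x
  simp only [Perm.mul_apply]
  by_cases hx : G.edgeOf x = G.edgeOf d
  · rw [flip_of_mem G (hx ▸ hd), flip_of_notMem G fun h => h.2 hx]
    rcases (sameCycle_involution G.inv_inv).1 (cyc_eq_iff.1 hx.symm) with rfl | rfl
    · rw [G.curves_left]
    · rw [G.curves_right, G.inv_inv]
  · have h1 : ∀ y, G.edgeOf y = G.edgeOf x → G.curves d y = G.rot y := by
      intro y hy
      refine G.curves_of_ne d ?_ ?_
      · rintro rfl
        exact hx hy.symm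
      · rintro rfl
        exact hx (hy.symm.trans (G.edgeOf_inv d))
    by_cases h : G.edgeOf x ∈ A
    · rw [flip_of_mem G h, flip_of_mem G (A := A \ {G.edgeOf d}) ⟨h, hx⟩, h1 _ (G.edgeOf_inv x)]
    · rw [flip_of_notMem G h, flip_of_notMem G fun h' => h h'.1, h1 _ rfl]

theorem rot_mul_flip_of_notMem (d : G.Dart) {A : Set G.Edge} (hd : G.edgeOf d ∉ A) :
    G.rot * G.flip A = G.rot * G.flip (A \ {G.edgeOf d}) := by
  rw [Set.sdiff_singleton_eq_self hd]

/-- The removal of an edge from the data of a spanning ribbon subgraph. The vertices (or boundary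
components) after the removal are the cycles of `q` and the isolated vertices. -/
theorem exists_removal (d : G.Dart) (ρ : Perm G.Dart) {B : Type} [Finite B] (p : Perm G.Dart)
    (p' q : Perm (G.removeEdge d ρ).Dart) (S : Set G.Edge) (S' : Set (G.removeEdge d ρ).Edge)
    (β : G.Dart → B) (βI : G.Isolated → B) (w w' : B → ℕ) (m : B → B)
    (f : Cycles q ⊕ (G.removeEdge d ρ).Isolated → B)
    (A : Set G.Edge) (hp : p = ρ * G.flip (A \ {G.edgeOf d})) (hp' : p' = skipTwo p d (G.inv d))
    (hS : ∀ k : (G.removeEdge d ρ).Dart, (G.removeEdge d ρ).edgeOf k ∈ S' ↔ G.edgeOf k.1 ∈ S)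
    (hβ : ∀ b, (∃ h, β h = b) ∨ ∃ i, βI i = b)
    (hcomp : ∀ h, (Side.mk G.Dart G.Isolated B G.inv p S β βI w).comp (β (p h)) =
      (Side.mk G.Dart G.Isolated B G.inv p S β βI w).comp (β h))
    (hm₁ : m (β (ρ d)) = m (β d)) (hm₂ : m (β (ρ (G.inv d))) = m (β (G.inv d)))
    (hf : ∀ k, f (Sum.inl (cyc q k)) = m (β k.1))
    (hfI : ∀ i, f (Sum.inr (Sum.inl i)) = m (βI i))
    (hfN : ∀ c, ∃ h, cyc ρ h = c.1 ∧ f (Sum.inr (Sum.inr c)) = m (β h)) :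
    ∃ r : (Side.mk G.Dart G.Isolated B G.inv p S β βI w).Removal
      (Side.mk (G.removeEdge d ρ).Dart (G.removeEdge d ρ).Isolated
        (WeightedPartition.ofMap f w').Blocks (G.removeEdge d ρ).inv p' S'
        (fun k => (WeightedPartition.ofMap f w').block (Sum.inl (cyc q k)))
        (fun i => (WeightedPartition.ofMap f w').block (Sum.inr i))
        (WeightedPartition.ofMap f w').weight) d,
      (∀ b c, r.φ b = r.φ c ↔ m b = m c) ∧
        ∀ b, (WeightedPartition.ofMap f w').weight (r.φ b) = w' (m b) := by
  let Z : Set G.Dart := {h | h = d ∨ h = G.inv d}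
  have hmZ : ∀ z ∈ Z, m (β (ρ z)) = m (β z) := by
    rintro z (rfl | rfl)
    · exact hm₁
    · exact hm₂
  have hfN' : ∀ c h, cyc ρ h = c.1 → f (Sum.inr (Sum.inr c)) = m (β h) := by
    intro c h hh
    obtain ⟨k, hk, e⟩ := hfN c
    rw [e]
    refine sameCycle_invariant_on (f := fun h => m (β h)) hmZ (x := h) (fun y hy => ?_)
      (cyc_eq_iff.1 (hh.trans hk.symm))
    exact c.2 y ((cyc_eq_iff.2 hy).symm.trans hh)
  -- No united block becomes empty: it keeps a surviving dart, a new isolated vertex or an old one.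
  have hex : ∀ b, ∃ v, f v = m b := by
    intro b
    rcases hβ b with ⟨h, rfl⟩ | ⟨i, rfl⟩
    · rcases exists_first_notMem (f := fun h => m (β h)) hmZ h with ⟨k, hk, e⟩ | hsm
      · exact ⟨Sum.inl (cyc q ⟨k, not_or.1 hk⟩), (hf _).trans e⟩
      · exact ⟨_, hfN' ⟨cyc ρ h, fun y hy => hsm y (cyc_eq_iff.1 hy.symm)⟩ h rfl⟩
    · exact ⟨_, hfI i⟩
  -- On the two ends `p` and `ρ` agree, so their cycles inside `Z` are the same. This matches the
  -- lost boundary cycles with the isolated vertices that `removeEdge` adds.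
  have hpZ : ∀ z ∈ Z, p z = ρ z := by
    rintro z (rfl | rfl)
    · rw [hp, Perm.mul_apply, flip_of_notMem G fun h => h.2 rfl]
    · rw [hp, Perm.mul_apply, flip_of_notMem G fun h => h.2 (G.edgeOf_inv d)]
  choose v hv using hex
  have hφ : ∀ b u, (WeightedPartition.ofMap f w').block (v b) =
      (WeightedPartition.ofMap f w').block u ↔ m b = f u := by
    intro b u
    rw [← hv b]
    exact ⟨fun h => Quotient.exact h, fun h => Quotient.sound' h⟩
  refine ⟨{
    inv_inv := G.inv_inv
    comp_bdry := hcomp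
    φ := fun b => (WeightedPartition.ofMap f w').block (v b)
    φ_surj := ?_
    ψ := Subtype.val
    ψ_inj := Subtype.val_injective
    ψ_range := fun h => ⟨fun ⟨k, e⟩ => e ▸ k.2, fun hh => ⟨⟨h, hh⟩, rfl⟩⟩
    ψ_inv := fun k => rfl
    ψ_S := hS
    ψ_bdry := fun h k => by
      subst hp'
      exact sameCycle_skipTwo p d (G.inv d) h k
    ψ_blk := fun k => ((hφ _ _).2 (hf k).symm).symm
    χ := Sum.inl
    χ_inj := Sum.inl_injective
    χ_blk := fun i => ((hφ _ _).2 (hfI i).symm).symm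
    ι := fun h => Sum.inr ⟨cyc ρ h.1, fun k hk => h.2 k
      ((sameCycle_of_agree hpZ h.2 k).2 (cyc_eq_iff.1 hk.symm))⟩
    ι_eq := fun h k => ?_
    ι_blk := fun h => ((hφ _ _).2 (hfN' _ h.1 rfl).symm).symm
    χ_ne_ι := fun i h => Sum.inl_ne_inr
    cover := ?_ }, ?_, ?_⟩
  · intro b'
    obtain ⟨u, rfl⟩ := Quotient.exists_rep b'
    suffices h : ∃ b, m b = f u by
      obtain ⟨b, hb⟩ := h
      exact ⟨b, (hφ _ _).2 hb⟩
    rcases u with c | i | c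
    · obtain ⟨k, rfl⟩ := exists_cyc c
      exact ⟨_, (hf k).symm⟩
    · exact ⟨_, (hfI i).symm⟩
    · obtain ⟨h, -, e⟩ := hfN c
      exact ⟨_, e.symm⟩
  · exact Sum.inr_injective.eq_iff.trans (Subtype.mk_eq_mk.trans (cyc_eq_iff.trans
      (sameCycle_of_agree hpZ h.2 k.1).symm))
  · rintro (i | ⟨c, hc⟩)
    · exact Or.inl ⟨i, rfl⟩
    · obtain ⟨h, rfl⟩ := exists_cyc c
      refine Or.inr ⟨⟨h, fun k hk => hc k (cyc_eq_iff.2 ?_)⟩, rfl⟩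
      refine ((sameCycle_of_agree (p := ρ) (q := p) (Z := Z) (fun z hz => (hpZ z hz).symm)
        (fun y hy => hc y (cyc_eq_iff.2 hy.symm)) k).2 hk).symm
  · intro b c
    exact (hφ _ _).trans (by rw [hv])
  · intro b
    exact congrArg w' (hv b)

end RibbonGraph

theorem WeightedPartition.merge_eq_merge {X : Type} (P : WeightedPartition X)
    (b₁ b₂ b c : P.Blocks) : P.merge b₁ b₂ b = P.merge b₁ b₂ c ↔
      b = c ∨ (b = b₁ ∨ b = b₂) ∧ (c = b₁ ∨ c = b₂) := by
  unfold merge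
  split_ifs with h1 h2 h2
  · simp [h1, h2]
  · subst h1
    simp only [true_and, or_true, h2, or_false]
    constructor
    · exact fun h => Or.inr h.symm
    · rintro (rfl | rfl)
      · exact absurd rfl h2
      · rfl
  · subst h2
    simp only [or_true, and_true, h1, or_false, false_or]
  · simp only [h1, h2, or_false]
    constructor
    · exact Or.inl
    · rintro (rfl | ⟨rfl, rfl⟩) <;> rfl

namespace PackagedRibbonGraph

variable (G : PackagedRibbonGraph)

/-- The data of the vertices of the spanning ribbon subgraph with edge set `A`. -/
noncomputable def vertSide (A : Set G.graph.Edge) : Side := G.graph.side G.vert A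

/-- The data of the dual vertices of the spanning ribbon subgraph of the dual whose edge set is the
complement of `A`. -/
noncomputable def faceSide (A : Set G.graph.Edge) : Side := G.graph.dual.side G.face Aᶜ

theorem vblock_or (b : G.vert.Blocks) :
    (∃ h, G.vblock h = b) ∨ ∃ i, G.vert.block (Sum.inr i) = b := by
  obtain ⟨c | i, rfl⟩ := Quotient.exists_rep b
  · obtain ⟨h, rfl⟩ := exists_cyc c
    exact Or.inl ⟨h, rfl⟩
  · exact Or.inr ⟨i, rfl⟩

theorem fblock_or (b : G.face.Blocks) :
    (∃ h, G.fblock h = b) ∨ ∃ i, G.face.block (Sum.inr i) = b := by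
  obtain ⟨c | i, rfl⟩ := Quotient.exists_rep b
  · obtain ⟨h, rfl⟩ := exists_cyc c
    exact Or.inl ⟨h, rfl⟩
  · exact Or.inr ⟨i, rfl⟩

theorem vblock_rot (h : G.graph.Dart) : G.vblock (G.graph.rot h) = G.vblock h :=
  congrArg G.vert.block (G.graph.rot_vertexOf h)

theorem fblock_rot (h : G.graph.Dart) : G.fblock (G.graph.rot h) = G.fblock (G.graph.inv h) :=
  congrArg G.face.block (G.graph.rot_faceOf h)

variable {G} {d : G.graph.Dart} {A : Set G.graph.Edge}

/-- This and the next three removals instantiate `exists_removal`: `ρ` is `rot` for deletion and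
`curves` for contraction, and `m` is the identity where blocks stay and `merge` where they are
united. For faces the edge set is `Aᶜ`, but the boundary permutation is still that of `A`. -/
theorem delete_vertSide {A' : Set (G.delete d).graph.Edge}
    (hA : ∀ k, (G.delete d).graph.edgeOf k ∈ A' ↔ G.graph.edgeOf k.1 ∈ A)
    (hd : G.graph.edgeOf d ∉ A) :
    ∃ r : (G.vertSide A).Removal ((G.delete d).vertSide A') d,
      (∀ b c, r.φ b = r.φ c ↔ b = c) ∧
        ∀ b, ((G.delete d).vertSide A').w (r.φ b) = G.vert.weight b :=
  G.graph.exists_removal d G.graph.rot _ _ (G.delete d).graph.rot A A' G.vblock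
    (fun i => G.vert.block (Sum.inr i)) G.vert.weight G.vert.weight id
    (fun v => G.vert.block (G.deleteVertexMap d v)) A (G.graph.rot_mul_flip_of_notMem d hd)
    ((G.graph.removeEdge_bdry d _ A A' hA).trans
      (by rw [← G.graph.rot_mul_flip_of_notMem d hd]))
    hA G.vblock_or (RibbonGraph.side_comp_bdry G.vert A) (G.vblock_rot _) (G.vblock_rot _)
    (fun _ => rfl) (fun _ => rfl)
    (fun c => by
      obtain ⟨h, hh⟩ := exists_cyc c.1
      exact ⟨h, hh, congrArg (fun c => G.vert.block (Sum.inl c)) hh.symm⟩)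

theorem contract_vertSide {A' : Set (G.contract d).graph.Edge}
    (hA : ∀ k, (G.contract d).graph.edgeOf k ∈ A' ↔ G.graph.edgeOf k.1 ∈ A)
    (hd : G.graph.edgeOf d ∈ A) :
    ∃ r : (G.vertSide A).Removal ((G.contract d).vertSide A') d,
      (∀ b c, r.φ b = r.φ c ↔ G.vert.merge (G.vblock d) (G.vblock (G.graph.inv d)) b =
        G.vert.merge (G.vblock d) (G.vblock (G.graph.inv d)) c) ∧
        ∀ b, ((G.contract d).vertSide A').w (r.φ b) =
          G.vert.mergeWeight (G.vblock d) (G.vblock (G.graph.inv d))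
            (G.vert.merge (G.vblock d) (G.vblock (G.graph.inv d)) b) :=
  G.graph.exists_removal d (G.graph.curves d) _ _ (G.contract d).graph.rot A A' G.vblock
    (fun i => G.vert.block (Sum.inr i)) G.vert.weight
    (G.vert.mergeWeight (G.vblock d) (G.vblock (G.graph.inv d)))
    (G.vert.merge (G.vblock d) (G.vblock (G.graph.inv d)))
    (G.contractVertexBlock d) A (G.graph.rot_mul_flip_of_mem d hd)
    ((G.graph.removeEdge_bdry d _ A A' hA).trans
      (by rw [← G.graph.rot_mul_flip_of_mem d hd]))
    hA G.vblock_or (RibbonGraph.side_comp_bdry G.vert A)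
    (by rw [G.graph.curves_left, G.vblock_rot, WeightedPartition.merge_left,
      WeightedPartition.merge_right])
    (by rw [G.graph.curves_right, G.vblock_rot, WeightedPartition.merge_left,
      WeightedPartition.merge_right])
    (fun _ => rfl) (fun _ => rfl)
    (fun c => by
      obtain ⟨h, hh⟩ := exists_cyc c.1
      refine ⟨h, hh, ?_⟩
      change G.vblock d = _
      rcases c.2 h hh with rfl | rfl
      · rw [WeightedPartition.merge_left]
      · rw [WeightedPartition.merge_right])

theorem compl_iff {E E' D : Type} {A : Set E} {A' : Set E'} {f : D → E} {f' : D → E'}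
    (hA : ∀ k, f' k ∈ A' ↔ f k ∈ A) (k : D) : f' k ∈ A'ᶜ ↔ f k ∈ Aᶜ :=
  not_congr (hA k)

theorem contract_faceSide {A' : Set (G.contract d).graph.Edge}
    (hA : ∀ k, (G.contract d).graph.edgeOf k ∈ A' ↔ G.graph.edgeOf k.1 ∈ A)
    (hd : G.graph.edgeOf d ∈ A) :
    ∃ r : (G.faceSide A).Removal ((G.contract d).faceSide A') d,
      (∀ b c, r.φ b = r.φ c ↔ b = c) ∧
        ∀ b, ((G.contract d).faceSide A').w (r.φ b) = G.face.weight b :=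
  G.graph.exists_removal d (G.graph.curves d) _ _
    ((G.contract d).graph.rot * (G.contract d).graph.inv) Aᶜ A'ᶜ G.fblock
    (fun i => G.face.block (Sum.inr i)) G.face.weight G.face.weight id
    (fun v => G.face.block (G.contractFaceMap d v)) A
    ((RibbonGraph.dual_bdry A G.face).trans (G.graph.rot_mul_flip_of_mem d hd))
    ((RibbonGraph.dual_bdry A' (G.contract d).face).trans
      ((G.graph.removeEdge_bdry d _ A A' hA).trans
      (by rw [← G.graph.rot_mul_flip_of_mem d hd, ← RibbonGraph.dual_bdry A G.face]; rfl)))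
    (compl_iff hA) G.fblock_or (RibbonGraph.side_comp_bdry (G := G.graph.dual) G.face Aᶜ)
    (by rw [G.graph.curves_left, G.fblock_rot, G.graph.inv_inv])
    (by rw [G.graph.curves_right, G.fblock_rot])
    (fun _ => rfl) (fun _ => rfl)
    (fun c => ⟨Quotient.out c.1, Quotient.out_eq c.1, rfl⟩)

theorem delete_faceSide {A' : Set (G.delete d).graph.Edge}
    (hA : ∀ k, (G.delete d).graph.edgeOf k ∈ A' ↔ G.graph.edgeOf k.1 ∈ A)
    (hd : G.graph.edgeOf d ∉ A) :
    ∃ r : (G.faceSide A).Removal ((G.delete d).faceSide A') d,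
      (∀ b c, r.φ b = r.φ c ↔ G.face.merge (G.fblock d) (G.fblock (G.graph.inv d)) b =
        G.face.merge (G.fblock d) (G.fblock (G.graph.inv d)) c) ∧
        ∀ b, ((G.delete d).faceSide A').w (r.φ b) =
          G.face.mergeWeight (G.fblock d) (G.fblock (G.graph.inv d))
            (G.face.merge (G.fblock d) (G.fblock (G.graph.inv d)) b) :=
  G.graph.exists_removal d G.graph.rot _ _
    ((G.delete d).graph.rot * (G.delete d).graph.inv) Aᶜ A'ᶜ G.fblock
    (fun i => G.face.block (Sum.inr i)) G.face.weight
    (G.face.mergeWeight (G.fblock d) (G.fblock (G.graph.inv d)))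
    (G.face.merge (G.fblock d) (G.fblock (G.graph.inv d)))
    (G.deleteFaceBlock d) A
    ((RibbonGraph.dual_bdry A G.face).trans (G.graph.rot_mul_flip_of_notMem d hd))
    ((RibbonGraph.dual_bdry A' (G.delete d).face).trans
      ((G.graph.removeEdge_bdry d _ A A' hA).trans
      (by rw [← G.graph.rot_mul_flip_of_notMem d hd, ← RibbonGraph.dual_bdry A G.face]; rfl)))
    (compl_iff hA) G.fblock_or (RibbonGraph.side_comp_bdry (G := G.graph.dual) G.face Aᶜ)
    (by rw [G.fblock_rot, WeightedPartition.merge_left, WeightedPartition.merge_right])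
    (by rw [G.fblock_rot, G.graph.inv_inv, WeightedPartition.merge_left,
      WeightedPartition.merge_right])
    (fun _ => rfl) (fun _ => rfl)
    (fun c => by
      obtain ⟨h, hh⟩ := exists_cyc c.1
      refine ⟨h, hh, ?_⟩
      change G.fblock d = _
      rcases c.2 h hh with rfl | rfl
      · rw [WeightedPartition.merge_left]
      · rw [WeightedPartition.merge_right])

end PackagedRibbonGraph

/-! ### The prefactors combined with the terms. -/

namespace Side.Removal

variable {s s' : Side} {d : s.D}

/-- The common prefactor and the term, when the blocks and the weights stay. -/
theorem pow_mul_term_of_notMem (r : s.Removal s' d) {R : Type} [CommRing R] (Z Y : R)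
    (yg : ℤ → R) (hd : cyc s.inv d ∉ s.S) (hφ : ∀ b c, r.φ b = r.φ c ↔ b = c)
    (hw : ∀ b, s'.w (r.φ b) = s.w b) :
    Z ^ Nat.card s.B * s.term Y yg = Z ^ Nat.card s'.B * s'.term Y yg := by
  have hi : Function.Injective r.φ := fun b c h => (hφ b c).1 h
  rw [r.term_eq_of_notMem Y yg hd hi hw,
    Nat.card_congr (Equiv.ofBijective r.φ ⟨hi, r.φ_surj⟩)]

open Classical in
/-- The common prefactor and the term, when the blocks at the edge are united. -/
theorem pow_mul_term_of_mem {X D I : Type} [Finite D] [Finite I] (P : WeightedPartition X)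
    [Finite P.Blocks] {inv p : Perm D} {S : Set (Cycles inv)} {β : D → P.Blocks} {βI : I → P.Blocks}
    {d : D} (r : (Side.mk D I P.Blocks inv p S β βI P.weight).Removal s' d)
    {R : Type} [CommRing R] (Z Y : R) (yg : ℤ → R) (hd : cyc inv d ∈ S)
    (hφ : ∀ b c, r.φ b = r.φ c ↔
      P.merge (β d) (β (inv d)) b = P.merge (β d) (β (inv d)) c)
    (hw : ∀ b, s'.w (r.φ b) =
      P.mergeWeight (β d) (β (inv d)) (P.merge (β d) (β (inv d)) b)) :
    Z ^ Nat.card P.Blocks * (Side.mk D I P.Blocks inv p S β βI P.weight).term Y yg =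
      (if β d = β (inv d) then Y else Z) * (Z ^ Nat.card s'.B * s'.term Y yg) := by
  obtain ⟨h1, h2⟩ := r.term_eq_of_mem Y yg hd
    (fun b c => (hφ b c).trans (P.merge_eq_merge _ _ b c))
    (fun b h1 h2 => by
      rw [hw]
      have h3 : P.merge (β d) (β (inv d)) b = b := if_neg h2
      rw [h3]
      exact if_neg h1)
    (fun h => by
      change β d = β (inv d) at h
      rw [hw, WeightedPartition.merge_left]
      exact (if_pos rfl).trans (if_pos h))
    (fun h => by
      change β d ≠ β (inv d) at h
      rw [hw, WeightedPartition.merge_left]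
      exact (if_pos rfl).trans (if_neg h))
  by_cases h : β d = β (inv d)
  · have h1' := h1.trans (congrArg (fun n => Y ^ n * s'.term Y yg) (if_pos h))
    have h2' : Nat.card P.Blocks = Nat.card s'.B := h2.trans (congrArg (_ + ·) (if_pos h))
    rw [h1', h2', if_pos h]
    ring
  · have h1' := h1.trans (congrArg (fun n => Y ^ n * s'.term Y yg) (if_neg h))
    have h2' : Nat.card P.Blocks = Nat.card s'.B + 1 := h2.trans (congrArg (_ + ·) (if_neg h))
    rw [h1', h2', if_neg h]
    ring

end Side.Removal

namespace PackagedRibbonGraph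

variable (G : PackagedRibbonGraph) {R : Type} [CommRing R] (Z Y : R) (yg : ℤ → R)

instance : Finite G.vert.Blocks := inferInstanceAs (Finite (Quotient _))

instance : Finite G.face.Blocks := inferInstanceAs (Finite (Quotient _))

/-- The factors from the vertices of a summand of the universal invariant. -/
noncomputable def vertTerm (A : Set G.graph.Edge) : R :=
  Z ^ Nat.card G.vert.Blocks * (G.vertSide A).term Y yg

/-- The factors from the boundary components of a summand of the universal invariant. -/
noncomputable def faceTerm (A : Set G.graph.Edge) : R :=
  Z ^ Nat.card G.face.Blocks * (G.faceSide A).term Y yg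

variable {G} {d : G.graph.Dart} {A : Set G.graph.Edge}

theorem vertTerm_delete {A' : Set (G.delete d).graph.Edge}
    (hA : ∀ k, (G.delete d).graph.edgeOf k ∈ A' ↔ G.graph.edgeOf k.1 ∈ A)
    (hd : G.graph.edgeOf d ∉ A) : G.vertTerm Z Y yg A = (G.delete d).vertTerm Z Y yg A' := by
  obtain ⟨r, hφ, hw⟩ := delete_vertSide hA hd
  exact r.pow_mul_term_of_notMem Z Y yg hd hφ hw

theorem faceTerm_contract {A' : Set (G.contract d).graph.Edge}
    (hA : ∀ k, (G.contract d).graph.edgeOf k ∈ A' ↔ G.graph.edgeOf k.1 ∈ A)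
    (hd : G.graph.edgeOf d ∈ A) : G.faceTerm Z Y yg A = (G.contract d).faceTerm Z Y yg A' := by
  obtain ⟨r, hφ, hw⟩ := contract_faceSide hA hd
  exact r.pow_mul_term_of_notMem Z Y yg (fun h => h hd) hφ hw

open Classical in
theorem vertTerm_contract {A' : Set (G.contract d).graph.Edge}
    (hA : ∀ k, (G.contract d).graph.edgeOf k ∈ A' ↔ G.graph.edgeOf k.1 ∈ A)
    (hd : G.graph.edgeOf d ∈ A) : G.vertTerm Z Y yg A =
      (if G.vblock d = G.vblock (G.graph.inv d) then Y else Z) *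
        (G.contract d).vertTerm Z Y yg A' := by
  obtain ⟨r, hφ, hw⟩ := contract_vertSide hA hd
  exact Side.Removal.pow_mul_term_of_mem G.vert r Z Y yg hd hφ hw

open Classical in
theorem faceTerm_delete {A' : Set (G.delete d).graph.Edge}
    (hA : ∀ k, (G.delete d).graph.edgeOf k ∈ A' ↔ G.graph.edgeOf k.1 ∈ A)
    (hd : G.graph.edgeOf d ∉ A) : G.faceTerm Z Y yg A =
      (if G.fblock d = G.fblock (G.graph.inv d) then Y else Z) *
        (G.delete d).faceTerm Z Y yg A' := by
  obtain ⟨r, hφ, hw⟩ := delete_faceSide hA hd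
  exact Side.Removal.pow_mul_term_of_mem (X := G.graph.Face) G.face r Z Y yg hd hφ hw

/-! ### The universal invariant -/

open MvPolynomial UniVar in
/-- The factors from the vertices of a summand of the universal invariant. -/
noncomputable def uniVert (A : Set G.graph.Edge) : MvPolynomial UniVar ℤ :=
  G.vertTerm (X κ) (X β) (fun j => X (b (j - 1))) A

open MvPolynomial UniVar in
/-- The factors from the boundary components of a summand of the universal invariant. -/
noncomputable def uniFace (A : Set G.graph.Edge) : MvPolynomial UniVar ℤ :=
  G.faceTerm (X τ) (X α) (fun j => X (a (j - 1))) A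

variable (G) in
/-- The universal deletion-contraction invariant. -/
noncomputable def universal : MvPolynomial UniVar ℤ := ∑ᶠ A, G.uniFace A * G.uniVert A

open MvPolynomial UniVar in
variable (G) in
theorem universal_eq : G.universal =
    X τ ^ Nat.card G.face.Blocks * X κ ^ Nat.card G.vert.Blocks *
      aeval substitution (tutte G) := by
  classical
  let _ := Fintype.ofFinite (Set G.graph.Edge)
  unfold universal tutte
  rw [finsum_eq_sum_of_fintype, finsum_eq_sum_of_fintype, map_sum, Finset.mul_sum]
  refine Finset.sum_congr rfl fun A _ => ?_
  let _ : Finite (Components (packaging G.graph.dual G.face Aᶜ)) :=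
    inferInstanceAs (Finite (Quot _))
  let _ : Finite (Components (packaging G.graph G.vert A)) := inferInstanceAs (Finite (Quot _))
  let _ := Fintype.ofFinite (Components (packaging G.graph.dual G.face Aᶜ))
  let _ := Fintype.ofFinite (Components (packaging G.graph G.vert A))
  have e₁ := RibbonGraph.side_term (G := G.graph.dual) (R := MvPolynomial UniVar ℤ) G.face Aᶜ (X α) fun j => X (a (j - 1))
  have e₂ := RibbonGraph.side_term (R := MvPolynomial UniVar ℤ) G.vert A (X β) fun j => X (b (j - 1))
  refine (congrArg₂ (fun u v => X τ ^ Nat.card G.face.Blocks * u *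
    (X κ ^ Nat.card G.vert.Blocks * v)) e₁.symm e₂.symm).trans ?_
  simp only [finprod_eq_prod_of_fintype, map_mul, map_pow, map_prod, aeval_X, substitution]
  ring

/-- A subset of `E` omits `e` or contains it. Two inclusions are needed because the deletion and the
contraction have different types of edges. -/
theorem sum_set_split {E E₁ E₂ M : Type} [Finite E] [AddCommMonoid M] {e : E} {i₁ : E₁ → E}
    {i₂ : E₂ → E} (h₁ : Function.Injective i₁) (h₂ : Function.Injective i₂)
    (r₁ : ∀ x, (∃ y, i₁ y = x) ↔ x ≠ e) (r₂ : ∀ x, (∃ y, i₂ y = x) ↔ x ≠ e) (F : Set E → M) :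
    ∑ᶠ A, F A = ∑ᶠ A₁ : Set E₁, F (i₁ '' A₁) + ∑ᶠ A₂ : Set E₂, F (insert e (i₂ '' A₂)) := by
  classical
  have := Finite.of_injective i₁ h₁
  have := Finite.of_injective i₂ h₂
  let _ := Fintype.ofFinite (Set E)
  let _ := Fintype.ofFinite (Set E₁)
  let _ := Fintype.ofFinite (Set E₂)
  let g : Set E₁ ⊕ Set E₂ → Set E := Sum.elim (fun A => i₁ '' A) fun A => insert e (i₂ '' A)
  have n₁ : ∀ A, e ∉ i₁ '' A := fun A ⟨y, _, hy⟩ => (r₁ e).1 ⟨y, hy⟩ rfl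
  have n₂ : ∀ A, e ∉ i₂ '' A := fun A ⟨y, _, hy⟩ => (r₂ e).1 ⟨y, hy⟩ rfl
  have hg : Function.Bijective g := by
    constructor
    · rintro (A | A) (A' | A') h
      · exact congrArg Sum.inl (h₁.image_injective h)
      · exact absurd (show e ∈ g (Sum.inl A) from h ▸ Set.mem_insert _ _) (n₁ A)
      · exact absurd (show e ∈ g (Sum.inl A') from h ▸ Set.mem_insert _ _) (n₁ A')
      · refine congrArg Sum.inr (h₂.image_injective ?_)
        rw [← Set.insert_sdiff_self_of_notMem (n₂ A), ← Set.insert_sdiff_self_of_notMem (n₂ A')]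
        exact congrArg (· \ {e}) h
    · intro A
      by_cases hA : e ∈ A
      · refine ⟨Sum.inr (i₂ ⁻¹' A), ?_⟩
        ext x
        constructor
        · rintro (rfl | ⟨y, hy, rfl⟩)
          · exact hA
          · exact hy
        · intro hx
          by_cases hxe : x = e
          · exact Or.inl hxe
          · obtain ⟨y, rfl⟩ := (r₂ x).2 hxe
            exact Or.inr ⟨y, hx, rfl⟩
      · refine ⟨Sum.inl (i₁ ⁻¹' A), ?_⟩
        ext x
        constructor
        · rintro ⟨y, hy, rfl⟩
          exact hy
        · intro hx
          obtain ⟨y, rfl⟩ := (r₁ x).2 fun h => hA (h ▸ hx)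
          exact ⟨y, hx, rfl⟩
  rw [finsum_eq_sum_of_fintype, finsum_eq_sum_of_fintype, finsum_eq_sum_of_fintype,
    ← hg.sum_comp, Fintype.sum_sum_type]
  rfl

end PackagedRibbonGraph

/-! ### Edge sets before and after the removal of an edge. -/

namespace RibbonGraph

variable (G : RibbonGraph) (d : G.Dart) (ρ : Perm G.Dart)

/-- The edges other than the removed one, as edges of the ribbon graph. -/
noncomputable def removeEdgeIncl : (G.removeEdge d ρ).Edge → G.Edge :=
  Cycles.lift (p := (G.removeEdge d ρ).inv) (fun h => G.edgeOf h.1) fun h => G.edgeOf_inv h.1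

theorem removeEdgeIncl_injective : Function.Injective (G.removeEdgeIncl d ρ) := by
  intro e e' h
  obtain ⟨k, rfl⟩ := exists_cyc e
  obtain ⟨k', rfl⟩ := exists_cyc e'
  refine cyc_eq_iff.2 ((sameCycle_involution (G.removeEdge d ρ).inv_inv).2 ?_)
  exact ((sameCycle_involution G.inv_inv).1 (cyc_eq_iff.1 h)).imp
    (fun h => Subtype.ext h) fun h => Subtype.ext h

theorem removeEdgeIncl_range (e : G.Edge) :
    (∃ e', G.removeEdgeIncl d ρ e' = e) ↔ e ≠ G.edgeOf d := by
  obtain ⟨h, rfl⟩ := exists_cyc e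
  have key : cyc G.inv h = G.edgeOf d ↔ h = d ∨ h = G.inv d :=
    eq_comm.trans (cyc_eq_iff.trans (sameCycle_involution G.inv_inv))
  constructor
  · rintro ⟨e', he⟩
    obtain ⟨k, rfl⟩ := exists_cyc e'
    rw [← he]
    exact fun h => not_or.2 k.2 ((eq_comm.trans (cyc_eq_iff.trans
      (sameCycle_involution G.inv_inv))).1 h)
  · intro hh
    exact ⟨cyc _ ⟨h, not_or.1 fun h' => hh (key.2 h')⟩, rfl⟩

theorem edgeOf_mem_image (A' : Set (G.removeEdge d ρ).Edge) (k : (G.removeEdge d ρ).Dart) :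
    (G.removeEdge d ρ).edgeOf k ∈ A' ↔ G.edgeOf k.1 ∈ G.removeEdgeIncl d ρ '' A' :=
  ((G.removeEdgeIncl_injective d ρ).mem_set_image (a := (G.removeEdge d ρ).edgeOf k)).symm

theorem edgeOf_notMem_image (A' : Set (G.removeEdge d ρ).Edge) :
    G.edgeOf d ∉ G.removeEdgeIncl d ρ '' A' := fun ⟨e, _, he⟩ =>
  (G.removeEdgeIncl_range d ρ _).1 ⟨e, he⟩ rfl

theorem edgeOf_mem_insert_image (A' : Set (G.removeEdge d ρ).Edge) (k : (G.removeEdge d ρ).Dart) :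
    (G.removeEdge d ρ).edgeOf k ∈ A' ↔
      G.edgeOf k.1 ∈ insert (G.edgeOf d) (G.removeEdgeIncl d ρ '' A') := by
  rw [edgeOf_mem_image, Set.mem_insert_iff]
  exact (or_iff_right ((G.removeEdgeIncl_range d ρ _).1
    ⟨(G.removeEdge d ρ).edgeOf k, rfl⟩)).symm

end RibbonGraph

namespace PackagedRibbonGraph

open MvPolynomial UniVar

open Classical in
theorem uniFace_mul_uniVert_delete (G : PackagedRibbonGraph) (d : G.graph.Dart)
    (A' : Set (G.delete d).graph.Edge) :
    G.uniFace (G.graph.removeEdgeIncl d G.graph.rot '' A') *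
      G.uniVert (G.graph.removeEdgeIncl d G.graph.rot '' A') =
    (if G.fblock d = G.fblock (G.graph.inv d) then X α else X τ) *
      ((G.delete d).uniFace A' * (G.delete d).uniVert A') := by
  have hd := G.graph.edgeOf_notMem_image d G.graph.rot A'
  have hA := G.graph.edgeOf_mem_image d G.graph.rot A'
  exact (congrArg₂ (· * ·) (faceTerm_delete _ _ _ hA hd) (vertTerm_delete _ _ _ hA hd)).trans
    (mul_assoc _ _ _)

open Classical in
theorem uniFace_mul_uniVert_contract (G : PackagedRibbonGraph) (d : G.graph.Dart)
    (A' : Set (G.contract d).graph.Edge) :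
    G.uniFace (insert (G.graph.edgeOf d) (G.graph.removeEdgeIncl d (G.graph.curves d) '' A')) *
      G.uniVert (insert (G.graph.edgeOf d) (G.graph.removeEdgeIncl d (G.graph.curves d) '' A')) =
    (if G.vblock d = G.vblock (G.graph.inv d) then X β else X κ) *
      ((G.contract d).uniFace A' * (G.contract d).uniVert A') := by
  have hd := Set.mem_insert (G.graph.edgeOf d) (G.graph.removeEdgeIncl d (G.graph.curves d) '' A')
  have hA := G.graph.edgeOf_mem_insert_image d (G.graph.curves d) A'
  exact (congrArg₂ (· * ·) (faceTerm_contract _ _ _ hA hd) (vertTerm_contract _ _ _ hA hd)).trans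
    (mul_left_comm _ _ _)

open Classical in
theorem universal_rel (G : PackagedRibbonGraph) (d : G.graph.Dart) : G.universal =
    (if G.fblock d = G.fblock (G.graph.inv d) then X α else X τ) * (G.delete d).universal +
    (if G.vblock d = G.vblock (G.graph.inv d) then X β else X κ) * (G.contract d).universal :=
  (sum_set_split (e := G.graph.edgeOf d) (G.graph.removeEdgeIncl_injective d G.graph.rot)
    (G.graph.removeEdgeIncl_injective d (G.graph.curves d))
    (G.graph.removeEdgeIncl_range d G.graph.rot)
    (G.graph.removeEdgeIncl_range d (G.graph.curves d))
    (fun A => G.uniFace A * G.uniVert A)).trans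
  (congrArg₂ (· + ·)
    ((finsum_congr (G.uniFace_mul_uniVert_delete d)).trans (mul_finsum _ _).symm)
    ((finsum_congr (G.uniFace_mul_uniVert_contract d)).trans (mul_finsum _ _).symm))

end PackagedRibbonGraph

/-! ### Ribbon graphs without edges -/

namespace Side

/-- Without edges every block is a component, with twice the genus equal to $2+(w-1)$ minus the
number of its isolated vertices. The substitution subtracts the remaining 1. -/
theorem pow_mul_term_of_isEmpty (s : Side) [IsEmpty s.D] {R : Type} [CommRing R] (Z Y : R)
    (yg : ℤ → R) : Z ^ Nat.card s.B * s.term Y yg =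
      ∏ᶠ b, Z * yg (1 + (s.w b : ℤ) - ({i | s.blkI i = b}.ncard : ℤ)) := by
  classical
  let Φ : s.B ≃ s.Comp := ⟨s.comp, Quot.lift id fun _ _ ⟨h, _⟩ => isEmptyElim h, fun _ => rfl,
    fun c => by obtain ⟨b, rfl⟩ := s.comp_surjective c; rfl⟩
  let _ := Fintype.ofFinite s.B
  have hS : s.S = ∅ := Set.eq_empty_of_forall_notMem fun e _ => by
    obtain ⟨h, -⟩ := exists_cyc e
    exact isEmptyElim h
  have hn : s.null = 0 := by
    unfold null
    rw [hS, Set.ncard_empty, zero_add, Nat.card_congr Φ, Nat.sub_self]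
  have hg : ∀ b, s.genus (Φ b) = 1 + (s.w b : ℤ) - ({i | s.blkI i = b}.ncard : ℤ) := by
    intro b
    have e1 : s.edges (Φ b) = ∅ := Set.eq_empty_of_forall_notMem fun e ⟨h, _⟩ => isEmptyElim h
    have e2 : cyc s.bdry '' {h | s.blk h = b} = ∅ :=
      Set.eq_empty_of_forall_notMem fun e ⟨h, _⟩ => isEmptyElim h
    have e3 : ∀ c, s.comp c = Φ b ↔ c = b := fun c => Φ.injective.eq_iff (a := c)
    unfold genus reducedWeight numBdry
    simp only [e1, e2, e3, Set.ncard_empty, finsum_eq_sum_of_fintype, Finset.sum_ite_eq',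
      Finset.mem_univ, if_true]
    push_cast
    ring
  unfold term
  rw [hn, pow_zero, one_mul, ← finprod_comp_equiv Φ (f := fun c => yg (s.genus c)),
    finprod_eq_prod_of_fintype, finprod_eq_prod_of_fintype, Finset.prod_mul_distrib,
    Finset.prod_const, Finset.card_univ, Nat.card_eq_fintype_card]
  simp only [hg]

/-! ### Isomorphisms -/

/-- Two maps of darts are needed under reversal of orientation: `e` respects edges and blocks, `θ`
respects boundary cycles. They need to agree only up to the component, by `hθb`. -/
theorem term_eq_of_equiv (s s' : Side) {R : Type} [CommRing R] (Y : R) (yg : ℤ → R)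
    (e : s.D → s'.D) (he : Function.Surjective e) (θ : s.D ≃ s'.D) (eI : s.I ≃ s'.I)
    (eB : s.B ≃ s'.B)
    (hinv : ∀ h k, cyc s.inv h = cyc s.inv k ↔ cyc s'.inv (e h) = cyc s'.inv (e k))
    (hS : ∀ h, cyc s'.inv (e h) ∈ s'.S ↔ cyc s.inv h ∈ s.S)
    (hblk : ∀ h, s'.blk (e h) = eB (s.blk h))
    (hblk' : ∀ h, s'.blk (s'.inv (e h)) = eB (s.blk (s.inv h)))
    (hI : ∀ i, s'.blkI (eI i) = eB (s.blkI i)) (hw : ∀ b, s'.w (eB b) = s.w b)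
    (hθ : ∀ h k, s.bdry.SameCycle h k ↔ s'.bdry.SameCycle (θ h) (θ k))
    (hθb : ∀ h, s'.comp (s'.blk (θ h)) = s'.comp (s'.blk (e h))) :
    s.term Y yg = s'.term Y yg := by
  obtain ⟨Φ, hΦ⟩ := exists_comp_equiv s s' eB eB.surjective
    (fun b c h => by rw [eB.injective h])
    (fun h hh => by rw [← hblk, ← hblk', comp_inv ((hS h).2 hh)])
    (fun k hk => by
      obtain ⟨h, rfl⟩ := he k
      exact ⟨h, (hS h).1 hk, (hblk h).symm, (hblk' h).symm⟩)
  have key : ∀ Q : Set s.D, ∀ Q' : Set s'.D, (∀ h, e h ∈ Q' ↔ h ∈ Q) →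
      (cyc s.inv '' {h | cyc s.inv h ∈ s.S ∧ h ∈ Q}).ncard =
        (cyc s'.inv '' {h | cyc s'.inv h ∈ s'.S ∧ h ∈ Q'}).ncard := by
    intro Q Q' hQ
    refine ncard_image_eq e ?_ fun h _ k _ => hinv h k
    ext k
    constructor
    · rintro ⟨h, hh, rfl⟩
      exact ⟨(hS h).2 hh.1, (hQ h).2 hh.2⟩
    · intro hk
      obtain ⟨h, rfl⟩ := he k
      exact ⟨h, ⟨(hS h).1 hk.1, (hQ h).1 hk.2⟩, rfl⟩
  have hSS : ∀ s : Side, s.S = cyc s.inv '' {h | cyc s.inv h ∈ s.S ∧ h ∈ Set.univ} := by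
    intro s
    ext x
    obtain ⟨k, rfl⟩ := exists_cyc x
    exact ⟨fun h => ⟨k, ⟨h, trivial⟩, rfl⟩, fun ⟨k, h, e⟩ => e ▸ h.1⟩
  rw [term_eq s s' Y yg 0 Φ ?_ ?_, pow_zero, one_mul]
  · intro c
    have h1 : (s.edges c).ncard = (s'.edges (Φ c)).ncard :=
      key {h | s.comp (s.blk h) = c} {h | s'.comp (s'.blk h) = Φ c} fun h => by
        simp only [Set.mem_ofPred_eq, hblk, ← hΦ, Φ.injective.eq_iff]
    have h2 : s.numBdry c = s'.numBdry (Φ c) := by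
      unfold numBdry
      congr 1
      · refine ncard_image_eq θ ?_ fun h _ k _ => by rw [cyc_eq_iff, cyc_eq_iff, hθ]
        ext k
        obtain ⟨h, rfl⟩ := θ.surjective k
        rw [θ.injective.mem_set_image]
        simp only [Set.mem_ofPred_eq, hθb, hblk, ← hΦ, Φ.injective.eq_iff]
      · refine Set.ncard_congr (fun i _ => eI i) ?_ (fun _ _ _ _ h => eI.injective h) ?_
        · intro i hi
          change s'.comp _ = _
          rw [hI, ← hΦ]
          exact congrArg Φ hi
        · intro i' hi'
          obtain ⟨i, rfl⟩ := eI.surjective i'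
          change s'.comp _ = _ at hi'
          rw [hI, ← hΦ] at hi'
          exact ⟨i, Φ.injective hi', rfl⟩
    have h3 : s.reducedWeight c = s'.reducedWeight (Φ c) := by
      classical
      unfold reducedWeight
      rw [← finsum_comp_equiv eB (f := fun b' => if s'.comp b' = Φ c then (s'.w b' : ℤ) - 1 else 0)]
      refine finsum_congr fun b => ?_
      simp only [← hΦ, Φ.injective.eq_iff, hw]
    unfold genus
    rw [h1, h2, h3]
  · unfold null
    rw [hSS s, hSS s', key Set.univ Set.univ fun _ => Iff.rfl, Nat.card_congr Φ, Nat.card_congr eB,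
      zero_add]

end Side

namespace PackagedRibbonGraph

open MvPolynomial UniVar

theorem universal_edgeless (G : PackagedRibbonGraph) (hG : IsEmpty G.graph.Edge) : G.universal =
    (∏ᶠ b : G.face.Blocks, X τ * X (a ((G.face.weight b : ℤ) - (G.face.size b : ℤ)))) *
      ∏ᶠ c : G.vert.Blocks, X κ * X (b ((G.vert.weight c : ℤ) - (G.vert.size c : ℤ))) := by
  have hD : IsEmpty G.graph.Dart := ⟨fun h => hG.false (G.graph.edgeOf h)⟩
  have hu : ∀ A : Set G.graph.Edge, A = ∅ := fun A =>
    Set.eq_empty_of_forall_notMem fun e _ => hG.false e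
  -- Without darts all vertices and boundary components are isolated, so the size of a block counts
  -- isolated vertices.
  have hs : ∀ {B : Type} {p : Perm G.graph.Dart} (f : Cycles p ⊕ G.graph.Isolated → B) (b : B),
      {v | f v = b}.ncard = {i | f (Sum.inr i) = b}.ncard := by
    intro B p f b
    rw [← Set.ncard_image_of_injective {i | f (Sum.inr i) = b}
      (Sum.inr_injective (α := Cycles p))]
    refine congrArg Set.ncard (Set.ext fun v => ?_)
    constructor
    · intro hv
      rcases v with c | i
      · obtain ⟨h, -⟩ := exists_cyc c
        exact isEmptyElim h
      · exact ⟨i, hv, rfl⟩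
    · rintro ⟨i, hi, rfl⟩
      exact hi
  have hV : G.uniVert ∅ =
      ∏ᶠ c : G.vert.Blocks, X κ * X (b ((G.vert.weight c : ℤ) - (G.vert.size c : ℤ))) := by
    have : IsEmpty (G.vertSide ∅).D := hD
    refine ((G.vertSide ∅).pow_mul_term_of_isEmpty _ _ _).trans (finprod_congr fun c => ?_)
    have h : G.vert.size c = {i | (G.vertSide ∅).blkI i = c}.ncard := hs G.vert.block c
    rw [h, add_sub_assoc, add_sub_cancel_left]
    rfl
  have hF : G.uniFace ∅ =
      ∏ᶠ c : G.face.Blocks, X τ * X (a ((G.face.weight c : ℤ) - (G.face.size c : ℤ))) := by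
    have : IsEmpty (G.faceSide ∅).D := hD
    refine ((G.faceSide ∅).pow_mul_term_of_isEmpty _ _ _).trans (finprod_congr fun c => ?_)
    have h : G.face.size c = {i | (G.faceSide ∅).blkI i = c}.ncard := hs G.face.block c
    rw [h, add_sub_assoc, add_sub_cancel_left]
    rfl
  unfold universal
  rw [finsum_eq_single _ ∅ fun A hA => absurd (hu A) hA, hV, hF]

/-! ### Existence and uniqueness. -/

theorem eta_eq (G : PackagedRibbonGraph) (d : G.graph.Dart) :
    (G.eta d = 1 ∧ G.fblock d = G.fblock (G.graph.inv d)) ∨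
      G.eta d = 2 ∧ G.fblock d ≠ G.fblock (G.graph.inv d) := by
  unfold eta
  by_cases h : G.fblock d = G.fblock (G.graph.inv d)
  · left
    rw [← h, Set.pair_eq_singleton, Set.ncard_singleton]
    exact ⟨rfl, rfl⟩
  · exact Or.inr ⟨Set.ncard_pair h, h⟩

theorem mu_eq (G : PackagedRibbonGraph) (d : G.graph.Dart) :
    (G.mu d = 1 ∧ G.vblock d = G.vblock (G.graph.inv d)) ∨
      G.mu d = 2 ∧ G.vblock d ≠ G.vblock (G.graph.inv d) := by
  unfold mu
  by_cases h : G.vblock d = G.vblock (G.graph.inv d)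
  · left
    rw [← h, Set.pair_eq_singleton, Set.ncard_singleton]
    exact ⟨rfl, rfl⟩
  · exact Or.inr ⟨Set.ncard_pair h, h⟩

theorem isUniversal_universal : IsUniversal universal := by
  classical
  refine ⟨?_, ?_, ?_, ?_, universal_edgeless⟩ <;>
  · intro G d h1 h2
    have h3 := G.eta_eq d
    have h4 := G.mu_eq d
    rw [h1] at h3
    rw [h2] at h4
    have h5 := G.universal_rel d
    norm_num at h3 h4
    simpa [h3, h4] using h5

theorem card_removeEdge_lt (G : RibbonGraph) (d : G.Dart) (ρ : Perm G.Dart) :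
    Nat.card (G.removeEdge d ρ).Dart < Nat.card G.Dart :=
  Finite.card_subtype_lt (p := fun h => h ≠ d ∧ h ≠ G.inv d) (x := d) fun h => h.1 rfl

/-- Deletion and contraction both lower the number of darts, and `eta` and `mu` take only the values
1 and 2, so some relation applies at every edge. -/
theorem _root_.PackagedRibbon.IsUniversal.unique {U U' : PackagedRibbonGraph → MvPolynomial UniVar ℤ}
    (hU : IsUniversal U) (hU' : IsUniversal U') : U = U' := by
  suffices h : ∀ (n : ℕ) (G : PackagedRibbonGraph), Nat.card G.graph.Dart = n → U G = U' G from
    funext fun G => h _ G rfl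
  intro n
  induction n using Nat.strong_induction_on with
  | _ n ih =>
    rintro G rfl
    rcases isEmpty_or_nonempty G.graph.Edge with hG | ⟨⟨e⟩⟩
    · rw [hU.edgeless G hG, hU'.edgeless G hG]
    · obtain ⟨d, -⟩ := exists_cyc e
      have h1 := ih _ (card_removeEdge_lt G.graph d G.graph.rot) (G.delete d) rfl
      have h2 := ih _ (card_removeEdge_lt G.graph d (G.graph.curves d)) (G.contract d) rfl
      rcases G.eta_eq d with ⟨he, -⟩ | ⟨he, -⟩ <;> rcases G.mu_eq d with ⟨hm, -⟩ | ⟨hm, -⟩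
      · rw [hU.rel_one_one G d he hm, hU'.rel_one_one G d he hm, h1, h2]
      · rw [hU.rel_one_two G d he hm, hU'.rel_one_two G d he hm, h1, h2]
      · rw [hU.rel_two_one G d he hm, hU'.rel_two_one G d he hm, h1, h2]
      · rw [hU.rel_two_two G d he hm, hU'.rel_two_two G d he hm, h1, h2]

/-! ### Invariance under isomorphism. -/

namespace Isomorphism

variable {G G' : PackagedRibbonGraph} (φ : G.Isomorphism G')

theorem cyc_inv_iff (h k : G.graph.Dart) : G.graph.edgeOf h = G.graph.edgeOf k ↔
    G'.graph.edgeOf (φ.dart h) = G'.graph.edgeOf (φ.dart k) := by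
  refine cyc_eq_iff.trans (Iff.trans ?_ cyc_eq_iff.symm)
  rw [sameCycle_involution G.graph.inv_inv, sameCycle_involution G'.graph.inv_inv, ← φ.map_inv,
    φ.dart.injective.eq_iff, φ.dart.injective.eq_iff]

/-- The bijection on the edges. -/
noncomputable def edge : G.graph.Edge ≃ G'.graph.Edge :=
  Quotient.congr φ.dart fun h k =>
    cyc_eq_iff.symm.trans ((φ.cyc_inv_iff h k).trans cyc_eq_iff)

/-- The bijection on the blocks of the vertices. -/
def vertBlocks : G.vert.Blocks ≃ G'.vert.Blocks := Quotient.congr φ.vertex φ.vert_rel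

/-- The bijection on the blocks of the boundary components. -/
def faceBlocks : G.face.Blocks ≃ G'.face.Blocks := Quotient.congr φ.face φ.face_rel

open Classical in
/-- Reflect the edges of `A` on the components whose orientation is reversed. -/
noncomputable def reflect (A : Set G.graph.Edge) : Perm G.graph.Dart :=
  Function.Involutive.toPerm (fun h => if φ.rev h then G.graph.flip A h else h) (by
    have hr : ∀ h, φ.rev (G.graph.flip A h) ↔ φ.rev h := by
      intro h
      by_cases hA : G.graph.edgeOf h ∈ A
      · rw [RibbonGraph.flip_of_mem _ hA, φ.rev_inv]
      · rw [RibbonGraph.flip_of_notMem _ hA]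
    intro h
    by_cases hh : φ.rev h
    · simp only [hh, if_true, hr, RibbonGraph.flip_flip]
    · simp only [hh, if_false])

theorem reflect_of_rev {A : Set G.graph.Edge} {h : G.graph.Dart} (hh : φ.rev h) :
    φ.reflect A h = G.graph.flip A h := if_pos hh

theorem reflect_of_not_rev {A : Set G.graph.Edge} {h : G.graph.Dart} (hh : ¬ φ.rev h) :
    φ.reflect A h = h := if_neg hh

variable {A : Set G.graph.Edge} {A' : Set G'.graph.Edge}
  (hA : ∀ h, G'.graph.edgeOf (φ.dart h) ∈ A' ↔ G.graph.edgeOf h ∈ A)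
include hA

theorem dart_flip (h : G.graph.Dart) : φ.dart (G.graph.flip A h) = G'.graph.flip A' (φ.dart h) := by
  by_cases h1 : G.graph.edgeOf h ∈ A
  · rw [RibbonGraph.flip_of_mem _ h1, RibbonGraph.flip_of_mem _ ((hA h).2 h1), φ.map_inv]
  · rw [RibbonGraph.flip_of_notMem _ h1, RibbonGraph.flip_of_notMem _ fun h' => h1 ((hA h).1 h')]

/-- Where the orientation is reversed, `rot` corresponds to its inverse. Since `(rot * flip)⁻¹ =
flip * rot⁻¹` is conjugate to `rot⁻¹ * flip` by the flip, the map `dart ∘ reflect` carries `p` to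
the inverse of `p'` there, and to `p'` elsewhere. A permutation and its inverse have the same
cycles. -/
theorem sameCycle_bdry (h k : G.graph.Dart) : (G.graph.rot * G.graph.flip A).SameCycle h k ↔
    (G'.graph.rot * G'.graph.flip A').SameCycle (φ.dart (φ.reflect A h))
      (φ.dart (φ.reflect A k)) := by
  set p := G.graph.rot * G.graph.flip A
  set p' := G'.graph.rot * G'.graph.flip A'
  let θ : G.graph.Dart ≃ G'.graph.Dart := (φ.reflect A).trans φ.dart
  have hrf : ∀ h, φ.rev (G.graph.flip A h) ↔ φ.rev h := by
    intro h
    by_cases hA : G.graph.edgeOf h ∈ A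
    · rw [RibbonGraph.flip_of_mem _ hA, φ.rev_inv]
    · rw [RibbonGraph.flip_of_notMem _ hA]
  have hr : ∀ h, φ.rev (p h) ↔ φ.rev h := fun h => (φ.rev_rot _).trans (hrf h)
  have h1 : ∀ h, ¬ φ.rev h → θ (p h) = p' (θ h) := by
    intro h hh
    change φ.dart (φ.reflect A (p h)) = p' (φ.dart (φ.reflect A h))
    rw [φ.reflect_of_not_rev fun h' => hh ((hr h).1 h'), φ.reflect_of_not_rev hh]
    change φ.dart (G.graph.rot (G.graph.flip A h)) = G'.graph.rot (G'.graph.flip A' (φ.dart h))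
    rw [φ.map_rot _ fun h' => hh ((hrf h).1 h'), φ.dart_flip hA]
  have h2 : ∀ h, φ.rev h → p' (θ (p h)) = θ h := by
    intro h hh
    change p' (φ.dart (φ.reflect A (p h))) = φ.dart (φ.reflect A h)
    rw [φ.reflect_of_rev ((hr h).2 hh), φ.reflect_of_rev hh, φ.dart_flip hA]
    change G'.graph.rot (G'.graph.flip A' (G'.graph.flip A' (φ.dart (G.graph.rot
      (G.graph.flip A h))))) = _
    rw [RibbonGraph.flip_flip, φ.map_rot_rev _ ((hrf h).2 hh), Equiv.apply_symm_apply]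
  constructor
  · intro hhk
    refine cyc_eq_iff.1 (sameCycle_invariant (f := fun h => cyc p' (θ h)) (fun h => ?_) hhk)
    by_cases hh : φ.rev h
    · rw [← h2 h hh, cyc_apply]
    · rw [h1 h hh, cyc_apply]
  · intro hhk
    have := sameCycle_invariant (f := fun y => cyc p (θ.symm y)) (fun y => ?_) hhk
    · change cyc p (θ.symm (θ h)) = cyc p (θ.symm (θ k)) at this
      rw [θ.symm_apply_apply, θ.symm_apply_apply] at this
      exact cyc_eq_iff.1 this
    · obtain ⟨h, rfl⟩ := θ.surjective y
      by_cases hh : φ.rev h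
      · obtain ⟨g, rfl⟩ := p.surjective h
        rw [h2 g ((hr g).1 hh), θ.symm_apply_apply, θ.symm_apply_apply, cyc_apply]
      · rw [← h1 h hh, θ.symm_apply_apply, θ.symm_apply_apply, cyc_apply]

theorem vertTerm_eq {R : Type} [CommRing R] (Z Y : R) (yg : ℤ → R) :
    G.vertTerm Z Y yg A = G'.vertTerm Z Y yg A' := by
  unfold vertTerm
  rw [Nat.card_congr φ.vertBlocks]
  congr 1
  have hb : ∀ h, G'.vblock (φ.dart h) = φ.vertBlocks (G.vblock h) := fun h =>
    congrArg G'.vert.block (φ.vertex_dart h).symm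
  have hb' : ∀ h, G'.vblock (G'.graph.inv (φ.dart h)) = φ.vertBlocks (G.vblock (G.graph.inv h)) :=
    fun h => by rw [← φ.map_inv, hb]
  have hθ : ∀ h, (G'.vertSide A').comp (G'.vblock (φ.dart (φ.reflect A h))) =
      (G'.vertSide A').comp (G'.vblock (φ.dart h)) := by
    intro h
    by_cases hh : φ.rev h
    · rw [φ.reflect_of_rev hh, φ.dart_flip hA]
      by_cases hA' : G'.graph.edgeOf (φ.dart h) ∈ A'
      · rw [RibbonGraph.flip_of_mem _ hA']
        exact Side.comp_inv (s := G'.vertSide A') hA'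
      · rw [RibbonGraph.flip_of_notMem _ hA']
    · rw [φ.reflect_of_not_rev hh]
  refine Side.term_eq_of_equiv (G.vertSide A) (G'.vertSide A') Y yg φ.dart φ.dart.surjective
    ((φ.reflect A).trans φ.dart) φ.isolated φ.vertBlocks φ.cyc_inv_iff hA hb hb'
    (fun i => congrArg G'.vert.block (φ.vertex_isolated i).symm) (fun b => ?_)
    (φ.sameCycle_bdry hA) hθ
  obtain ⟨v, rfl⟩ := Quotient.exists_rep b
  exact φ.vert_weight v

open Classical in
theorem faceTerm_eq {R : Type} [CommRing R] (Z Y : R) (yg : ℤ → R) :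
    G.faceTerm Z Y yg A = G'.faceTerm Z Y yg A' := by
  unfold faceTerm
  rw [Nat.card_congr φ.faceBlocks]
  congr 1
  let e : G.graph.Dart → G'.graph.Dart := fun h =>
    if φ.rev h then G'.graph.inv (φ.dart h) else φ.dart h
  have he : ∀ h, e (G.graph.inv h) = G'.graph.inv (e h) := by
    intro h
    by_cases hh : φ.rev h <;> simp only [e, φ.rev_inv, hh, if_true, if_false, φ.map_inv]
  have hee : ∀ h, G'.graph.edgeOf (e h) = G'.graph.edgeOf (φ.dart h) := by
    intro h
    by_cases hh : φ.rev h
    · simp only [e, hh, if_true, RibbonGraph.edgeOf_inv]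
    · simp only [e, hh, if_false]
  have hs : Function.Surjective e := by
    intro y
    obtain ⟨h, rfl⟩ := φ.dart.surjective y
    by_cases hh : φ.rev h
    · refine ⟨G.graph.inv h, ?_⟩
      rw [he]
      simp only [e, hh, if_true, G'.graph.inv_inv]
    · exact ⟨h, if_neg hh⟩
  have hb : ∀ h, G'.fblock (e h) = φ.faceBlocks (G.fblock h) := fun h =>
    congrArg G'.face.block (φ.face_dart h).symm
  have hb' : ∀ h, G'.fblock (G'.graph.inv (e h)) = φ.faceBlocks (G.fblock (G.graph.inv h)) :=
    fun h => by rw [← he, hb]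
  have hei : ∀ h k, G.graph.edgeOf h = G.graph.edgeOf k ↔
      G'.graph.edgeOf (e h) = G'.graph.edgeOf (e k) := fun h k => by
    rw [hee, hee, φ.cyc_inv_iff]
  have heA : ∀ h, G'.graph.edgeOf (e h) ∈ A'ᶜ ↔ G.graph.edgeOf h ∈ Aᶜ := fun h => by
    rw [hee, Set.mem_compl_iff, Set.mem_compl_iff, hA]
  -- At a reversed dart `e` always passes to the other end, whereas the reflection does so only for
  -- edges of `A`. For the other edges the two ends label the two dual vertices of an edge of `A'ᶜ`,
  -- which lie in one component.
  have hθ : ∀ h, (G'.faceSide A').comp (G'.fblock (φ.dart (φ.reflect A h))) =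
      (G'.faceSide A').comp (G'.fblock (e h)) := by
    intro h
    by_cases hh : φ.rev h
    · have heh : e h = G'.graph.inv (φ.dart h) := if_pos hh
      rw [φ.reflect_of_rev hh, φ.dart_flip hA, heh]
      by_cases hA' : G'.graph.edgeOf (φ.dart h) ∈ A'
      · rw [RibbonGraph.flip_of_mem _ hA']
      · rw [RibbonGraph.flip_of_notMem _ hA']
        exact (Side.comp_inv (s := G'.faceSide A') hA').symm
    · have heh : e h = φ.dart h := if_neg hh
      rw [φ.reflect_of_not_rev hh, heh]
  refine Side.term_eq_of_equiv (G.faceSide A) (G'.faceSide A') Y yg e hs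
    ((φ.reflect A).trans φ.dart) φ.isolated φ.faceBlocks hei heA hb hb'
    (fun i => congrArg G'.face.block (φ.face_isolated i).symm) (fun b => ?_)
    (fun h k => ?_) hθ
  · obtain ⟨f, rfl⟩ := Quotient.exists_rep b
    exact φ.face_weight f
  · have h1 : (G.faceSide A).bdry = G.graph.rot * G.graph.flip A := RibbonGraph.dual_bdry A G.face
    have h2 : (G'.faceSide A').bdry = G'.graph.rot * G'.graph.flip A' :=
      RibbonGraph.dual_bdry A' G'.face
    rw [h1, h2]
    exact φ.sameCycle_bdry hA h k

end Isomorphism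

variable {G G' : PackagedRibbonGraph}

theorem Isomorphism.universal_eq (φ : G.Isomorphism G') : G.universal = G'.universal := by
  unfold universal
  rw [← finsum_comp_equiv (Equiv.Set.congr φ.edge)]
  refine finsum_congr fun A => ?_
  have hA : ∀ h, G'.graph.edgeOf (φ.dart h) ∈ φ.edge '' A ↔ G.graph.edgeOf h ∈ A := fun h =>
    φ.edge.injective.mem_set_image (a := G.graph.edgeOf h)
  exact congrArg₂ (· * ·) (φ.faceTerm_eq hA _ _ _) (φ.vertTerm_eq hA _ _ _)

end PackagedRibbonGraph

end PackagedRibbon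

open PackagedRibbon in
theorem theorem3p4 :
    (∃! U : PackagedRibbonGraph → MvPolynomial UniVar ℤ, IsUniversal U) ∧
    ∀ U : PackagedRibbonGraph → MvPolynomial UniVar ℤ, IsUniversal U →
      (∀ G G' : PackagedRibbonGraph, Nonempty (G.Isomorphism G') → U G = U G') ∧
      ∀ G : PackagedRibbonGraph,
        U G = MvPolynomial.X UniVar.τ ^ Nat.card G.face.Blocks *
          MvPolynomial.X UniVar.κ ^ Nat.card G.vert.Blocks *
          MvPolynomial.aeval substitution (tutte G) := by
  have h := PackagedRibbonGraph.isUniversal_universal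
  refine ⟨⟨_, h, fun U hU => hU.unique h⟩, fun U hU => ?_⟩
  obtain rfl := hU.unique h
  exact ⟨fun G G' ⟨φ⟩ => φ.universal_eq, fun G => G.universal_eq⟩
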